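/- Let $X\subseteq\mathbb{R}$ be a set with non-empty interior. Let $k:\mathbb{R}\to\mathbb{R}$ be a non-constant positive definite function which is infinitely differentiable at the point $0$ and satisfies $k(0)=1$. Let $K(x,y)=k(x-y)$ for $x,y\in X$, and let $H(K)$ be the (real) reproducing kernel Hilbert space of functions on $X$ with kernel $K$. Let $\alpha$ be the spectral measure of $k$, that is, the finite Borel measure on $\mathbb{R}$ with $k(x)=\int_{-\infty}^{\infty}e^{itx}\,\alpha(dt)$ for all $x\in\mathbb{R}$. Assume that the Hamburger moment problem for $\alpha$ is determinate: all moments of $\alpha$ are finite, and $\alpha$ is the only Borel measure on $\mathbb{R}$ that has these moments. Then: (a) for every real $c\neq 0$, the constant function $f(x)=c$, $x\in X$, belongs to $H(K)$ if and only if $\alpha(\{0\})>0$; (b) if in addition $k$ is real analytic on $\mathbb{R}$, then $H(K)$ does not contain (the restriction to $X$ of) any non-constant polynomial. -/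

import Mathlib

open MeasureTheory
open scoped ContDiff

/-- `K : S → S → ℝ` is a positive definite kernel in the sense of RKHS theory: it is symmetric and
`∑ᵢⱼ cᵢ cⱼ K(xᵢ, xⱼ) ≥ 0` for all finite families of points and real coefficients. -/
def IsPosDefKernel {S : Type*} (K : S → S → ℝ) : Prop :=
  (∀ x y, K x y = K y x) ∧
    ∀ (s : Finset S) (c : S → ℝ), 0 ≤ ∑ x ∈ s, ∑ y ∈ s, c x * c y * K x y

/-- The translation-invariant kernel `K(x, y) = k(x - y)` on `X ⊆ ℝ`. -/
def translationKernel (k : ℝ → ℝ) (X : Set ℝ) (x y : X) : ℝ := k (x - y)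

/-- `k : ℝ → ℝ` is a positive definite function: `k(x - y)` is a positive definite kernel on `ℝ`. -/
def IsPosDefFun (k : ℝ → ℝ) : Prop := IsPosDefKernel fun x y : ℝ => k (x - y)

theorem IsPosDefFun.translationKernel {k : ℝ → ℝ} (hk : IsPosDefFun k) (X : Set ℝ) :
    IsPosDefKernel (translationKernel k X) := by
  classical
  refine ⟨fun x y => hk.1 x y, fun s c => ?_⟩
  have h := hk.2 (s.map (Function.Embedding.subtype _))
    (fun x => if hx : x ∈ X then c ⟨x, hx⟩ else 0)
  simpa [Finset.sum_map, _root_.translationKernel] using h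

/-- A real kernel, with its values regarded as operators on the one-dimensional space `ℝ`. -/
noncomputable def operatorKernel {S : Type*} (K : S → S → ℝ) : Matrix S S (ℝ →L[ℝ] ℝ) :=
  Matrix.of fun x y => K x y • ContinuousLinearMap.id ℝ ℝ

theorem IsPosDefKernel.posSemidef {S : Type*} {K : S → S → ℝ} (hK : IsPosDefKernel K) :
    (operatorKernel K).PosSemidef := by
  have tfae := (RKHS.posSemidef_tfae (K := operatorKernel K)).out 0 2
  rw [tfae]
  refine ⟨?_, fun v => ?_⟩
  · ext x y
    have h1 : star (ContinuousLinearMap.id ℝ ℝ) = ContinuousLinearMap.id ℝ ℝ := star_one _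
    simp [operatorKernel, Matrix.conjTranspose_apply, hK.1 x y, h1]
  · have h := hK.2 v.support v
    simp only [Finsupp.sum, operatorKernel, Matrix.of_apply]
    refine h.trans_eq ?_
    simp only [RCLike.re_to_real]
    refine Finset.sum_congr rfl fun x _ => Finset.sum_congr rfl fun y _ => ?_
    simp [hK.1 y x]
    ring

/-- The reproducing kernel Hilbert space `H(K)` of a positive definite kernel `K` on `S`,
as a set of functions `S → ℝ`. -/
noncomputable def rkhs {S : Type*} (K : S → S → ℝ) (hK : IsPosDefKernel K) : Set (S → ℝ) :=
  haveI : Fact (operatorKernel K).PosSemidef := ⟨hK.posSemidef⟩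
  Set.range fun h : RKHS.OfKernel (operatorKernel K) => (h : S → ℝ)

/-- `α` is the spectral measure of `k`: a finite measure with `k(x) = ∫ e^{itx} α(dt)`. -/
def IsSpectralMeasure (k : ℝ → ℝ) (α : Measure ℝ) : Prop :=
  IsFiniteMeasure α ∧ ∀ x : ℝ, (k x : ℂ) = ∫ t : ℝ, Complex.exp (Complex.I * t * x) ∂α

/-- All moments of the measure are finite. -/
def HasMoments (α : Measure ℝ) : Prop := ∀ n : ℕ, Integrable (fun t : ℝ => t ^ n) α

/-- The Hamburger moment problem for `α` is determinate: `α` has finite moments of all orders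
and is the only Borel measure on `ℝ` with these moments. -/
def HamburgerDeterminate (α : Measure ℝ) : Prop :=
  HasMoments α ∧ ∀ β : Measure ℝ, HasMoments β →
    (∀ n : ℕ, ∫ t, t ^ n ∂β = ∫ t, t ^ n ∂α) → β = α

/-! Every member of `H(K)` is a transform x ↦ ∫ χ(t) e^{itx} α(dt) with χ in L²(α). An atom at 0
yields the constants, from a density supported at 0. Conversely, let a transform be constant near
x₀. Differentiating at x₀ shows that ψ(t) = χ(t) e^{itx₀} annihilates t, t², t³, …; determinacy then
forces t ψ(t) = 0 almost everywhere, so ψ lives at 0, and without an atom there the constant would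
be 0.

The power 1 is missing from this list, so density of polynomials in L²(α) would not suffice.
Instead, `HamburgerDeterminate.exists_polynomial_ge` gives polynomial majorants with almost the same
integral: otherwise M. Riesz extension would produce a second measure with the same moments. Applied
to ±1/|t - z|² and factored into squared moduli, these majorants give polynomials U with U(z) = 1
and arbitrarily small L² norm (`HamburgerDeterminate.exists_eval_eq_one`). Writing U = 1 + (t - z)W
approximates t/(t - z) in L² by -tW, so the Stieltjes transform of tψ vanishes off the real line,
and inversion finishes (`HamburgerDeterminate.mul_self_ae_eq_zero`).

For polynomials, analyticity of k at 0 makes exp(r|t|) integrable for some r > 0, so transforms are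
real analytic on the whole line. A polynomial equal to a transform near one point equals it
everywhere, but transforms are bounded by ∫ |χ|. -/

/-! ### Reproducing kernel spaces through feature maps -/

/-- Equal Gram matrices make Σ cₓ b(x) ↦ Σ cₓ a(x) a well-defined isometry, so pairing with h is a
bounded functional on the span of b. Hahn–Banach extends it and Riesz represents it. -/
theorem exists_inner_eq_of_gram_eq {S H W : Type*} [NormedAddCommGroup H] [InnerProductSpace ℝ H]
    [NormedAddCommGroup W] [InnerProductSpace ℝ W] [CompleteSpace W] (a : S → H) (b : S → W)
    (hab : ∀ x y, inner ℝ (a x) (a y) = inner ℝ (b x) (b y)) (h : H) :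
    ∃ w : W, ∀ x, inner ℝ h (a x) = inner ℝ w (b x) := by
  let A : (S →₀ ℝ) →ₗ[ℝ] H := Finsupp.linearCombination ℝ a
  let B : (S →₀ ℝ) →ₗ[ℝ] W := Finsupp.linearCombination ℝ b
  have hAB : ∀ c, ‖A c‖ = ‖B c‖ := by
    intro c
    have : inner ℝ (A c) (A c) = inner ℝ (B c) (B c) := by
      simp only [A, B, Finsupp.linearCombination_apply, Finsupp.sum, sum_inner, inner_sum,
        inner_smul_left, inner_smul_right, hab]
    rw [real_inner_self_eq_norm_sq, real_inner_self_eq_norm_sq] at this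
    exact (sq_eq_sq₀ (norm_nonneg _) (norm_nonneg _)).1 this
  let l : (S →₀ ℝ) →ₗ[ℝ] ℝ := (innerSL ℝ h).toLinearMap ∘ₗ A
  have hker : LinearMap.ker B ≤ LinearMap.ker l := by
    intro c hc
    rw [LinearMap.mem_ker] at hc ⊢
    have : A c = 0 := by rw [← norm_eq_zero, hAB, hc, norm_zero]
    simp [l, this]
  obtain ⟨g, hg⟩ : ∃ g : W →ₗ[ℝ] ℝ, g ∘ₗ B = l := by
    have : l ∈ LinearMap.range B.dualMap := by
      rw [LinearMap.range_dualMap_eq_dualAnnihilator_ker]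
      exact (Submodule.mem_dualAnnihilator _).2 fun c hc => hker hc
    exact this
  let g' : LinearMap.range B →L[ℝ] ℝ :=
    (g.domRestrict (LinearMap.range B)).mkContinuous ‖h‖ (by
      rintro ⟨_, c, rfl⟩
      have h1 : g (B c) = l c := by rw [← hg]; rfl
      simp only [LinearMap.domRestrict_apply, h1]
      refine (norm_inner_le_norm h (A c)).trans (le_of_eq ?_)
      rw [hAB]
      rfl)
  obtain ⟨G, hG, -⟩ := exists_extension_norm_eq _ g'
  refine ⟨(InnerProductSpace.toDual ℝ W).symm G, fun x => ?_⟩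
  rw [InnerProductSpace.toDual_symm_apply]
  have h1 := hG ⟨B (Finsupp.single x 1), LinearMap.mem_range_self _ _⟩
  have h2 : g (B (Finsupp.single x 1)) = l (Finsupp.single x 1) := by rw [← hg]; rfl
  simp only [g', LinearMap.mkContinuous_apply, LinearMap.domRestrict_apply, h2] at h1
  simpa [A, B, l] using h1.symm

theorem mem_rkhs_iff {S W : Type*} [NormedAddCommGroup W] [InnerProductSpace ℝ W]
    [CompleteSpace W] {K : S → S → ℝ} (hK : IsPosDefKernel K) (b : S → W)
    (hb : ∀ x y, K x y = inner ℝ (b x) (b y)) (f : S → ℝ) :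
    f ∈ rkhs K hK ↔ ∃ w : W, ∀ x, f x = inner ℝ w (b x) := by
  have : Fact (operatorKernel K).PosSemidef := ⟨hK.posSemidef⟩
  let a : S → RKHS.OfKernel (operatorKernel K) := fun x => RKHS.kerFun _ x (1 : ℝ)
  have hgram : ∀ x y, inner ℝ (a x) (a y) = inner ℝ (b x) (b y) := by
    intro x y
    have h := RKHS.kernel_inner (RKHS.OfKernel (operatorKernel K)) y x (1 : ℝ) (1 : ℝ)
    rw [RKHS.OfKernel.kernel_ofKernel] at h
    rw [← hb, hK.1]
    simpa [operatorKernel, a] using h.symm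
  have hev : ∀ (h : RKHS.OfKernel (operatorKernel K)) x, h x = inner ℝ h (a x) := by
    intro h x
    simp [a]
  constructor
  · rintro ⟨h, rfl⟩
    obtain ⟨w, hw⟩ := exists_inner_eq_of_gram_eq a b hgram h
    exact ⟨w, fun x => (hev h x).trans (hw x)⟩
  · rintro ⟨w, hw⟩
    obtain ⟨h, hh⟩ := exists_inner_eq_of_gram_eq b a (fun x y => (hgram x y).symm) w
    exact ⟨h, funext fun x => by rw [hw, hh]; exact hev h x⟩

/-! ### Nonnegative real polynomials as squared moduli -/

open Polynomial in
-- Non-real roots come in conjugate pairs, and a real root is a minimum, hence at least double.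
-- Either way a quadratic (X - ζ)(X - ζ̄) splits off, and the degree drops by two.
theorem exists_eq_mul_map_conj_of_eval_nonneg (R : ℝ[X]) (hR : ∀ t : ℝ, 0 ≤ R.eval t) :
    ∃ S : ℂ[X], R.map (algebraMap ℝ ℂ) = S * S.map (starRingEnd ℂ) := by
  induction hn : R.natDegree using Nat.strong_induction_on generalizing R with
  | _ n ih =>
  by_cases h0 : R.natDegree = 0
  · rw [natDegree_eq_zero] at h0
    obtain ⟨a, rfl⟩ := h0
    have ha : 0 ≤ a := by simpa using hR 0
    refine ⟨C ((√a : ℝ) : ℂ), ?_⟩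
    simp only [map_C, Complex.coe_algebraMap, Complex.conj_ofReal, ← C_mul, ← Complex.ofReal_mul,
      Real.mul_self_sqrt ha]
  have hR0 : R ≠ 0 := by rintro rfl; simp at h0
  obtain ⟨ζ, hζ⟩ := IsAlgClosed.exists_aeval_eq_zero ℂ R
    (fun h => h0 (natDegree_eq_zero_iff_degree_le_zero.2 h.le))
  -- Covers both kinds of root. For real ζ the factor vanishes at `ζ.re`, and there the sign of the
  -- cofactor follows by continuity.
  have key : ∀ Q R' : ℝ[X], R = Q * R' → Q.natDegree = 2 → (∀ t : ℝ, t ≠ ζ.re → 0 < Q.eval t) →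
      Q.map (algebraMap ℝ ℂ) = (X - C ζ) * (X - C ((starRingEnd ℂ) ζ)) →
      ∃ S : ℂ[X], R.map (algebraMap ℝ ℂ) = S * S.map (starRingEnd ℂ) := by
    rintro Q R' rfl hQ hpos hQζ
    have hQ0 : Q ≠ 0 := left_ne_zero_of_mul hR0
    have hR'0 : R' ≠ 0 := right_ne_zero_of_mul hR0
    have hR' : ∀ t : ℝ, 0 ≤ R'.eval t := by
      have hcl : IsClosed {t : ℝ | 0 ≤ R'.eval t} := isClosed_le continuous_const R'.continuous
      have hsub : {ζ.re}ᶜ ⊆ {t : ℝ | 0 ≤ R'.eval t} := by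
        intro t ht
        have := hR t
        rw [eval_mul] at this
        exact nonneg_of_mul_nonneg_right this (hpos t ht)
      have hd : Dense ({ζ.re}ᶜ : Set ℝ) := dense_compl_singleton _
      intro t
      exact hcl.closure_subset_iff.2 hsub (hd t)
    obtain ⟨S, hS⟩ := ih R'.natDegree (by rw [natDegree_mul hQ0 hR'0] at hn; omega) R' hR' rfl
    refine ⟨(X - C ζ) * S, ?_⟩
    rw [Polynomial.map_mul, hQζ, hS]
    simp only [Polynomial.map_mul, Polynomial.map_sub, map_X, map_C]
    ring
  by_cases him : ζ.im = 0
  · have hζr : ζ = (ζ.re : ℂ) := by apply Complex.ext <;> simp [him]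
    have hroot : R.eval ζ.re = 0 := by
      rw [hζr] at hζ
      have h := aeval_algebraMap_apply ℂ ζ.re R
      rw [Complex.coe_algebraMap, hζ, ← Complex.ofReal_zero, Complex.ofReal_inj] at h
      simpa using h.symm
    obtain ⟨R1, hR1⟩ := dvd_iff_isRoot.2 hroot
    have hmin : IsLocalMin (fun t => R.eval t) ζ.re :=
      Filter.Eventually.of_forall fun t => by simpa [hroot] using hR t
    have hder : R.derivative.eval ζ.re = 0 := hmin.hasDerivAt_eq_zero (R.hasDerivAt ζ.re)
    have hR1r : R1.eval ζ.re = 0 := by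
      rw [hR1] at hder
      simpa using hder
    obtain ⟨R2, hR2⟩ := dvd_iff_isRoot.2 hR1r
    refine key ((X - C ζ.re) ^ 2) R2 (by rw [hR1, hR2]; ring) (by simp) ?_ ?_
    · intro t ht
      simp only [eval_pow, eval_sub, eval_X, eval_C]
      have := sub_ne_zero.2 ht
      positivity
    · rw [Complex.conj_eq_iff_im.2 him]
      conv_rhs => rw [hζr]
      simp [sq]
  · obtain ⟨R', hR'⟩ := quadratic_dvd_of_aeval_eq_zero_im_ne_zero R hζ him
    have hsq : ‖ζ‖ ^ 2 = ζ.re ^ 2 + ζ.im ^ 2 := by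
      rw [← Complex.normSq_eq_norm_sq, Complex.normSq_apply]; ring
    refine key _ R' hR' ?_ ?_ ?_
    · compute_degree!
    · intro t _
      simp only [eval_add, eval_sub, eval_pow, eval_X, eval_mul, eval_C, hsq]
      have : 0 < ζ.im ^ 2 := by positivity
      nlinarith [sq_nonneg (t - ζ.re)]
    · simp only [Polynomial.map_add, Polynomial.map_sub, Polynomial.map_mul, Polynomial.map_pow,
        map_X, map_C, Complex.coe_algebraMap]
      have h1 : ((2 * ζ.re : ℝ) : ℂ) = ζ + (starRingEnd ℂ) ζ := by rw [Complex.add_conj]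
      have h2 : ((‖ζ‖ ^ 2 : ℝ) : ℂ) = ζ * (starRingEnd ℂ) ζ := by
        rw [Complex.mul_conj, Complex.normSq_eq_norm_sq]
      rw [h1, h2]
      simp only [C_add, C_mul]
      ring

/-! ### Positive functionals on functions of polynomial growth -/

open Filter Topology

/-- The continuous functions on `ℝ` whose absolute value is dominated by a polynomial. -/
def polyGrowth : Submodule ℝ (ℝ → ℝ) where
  carrier := {g | Continuous g ∧ ∃ q : Polynomial ℝ, ∀ t, |g t| ≤ q.eval t}
  add_mem' := by
    rintro f g ⟨hf, p, hp⟩ ⟨hg, q, hq⟩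
    refine ⟨hf.add hg, p + q, fun t => ?_⟩
    rw [Polynomial.eval_add]
    exact (abs_add_le _ _).trans (add_le_add (hp t) (hq t))
  zero_mem' := ⟨continuous_const, 0, fun t => by simp⟩
  smul_mem' := by
    rintro c f ⟨hf, p, hp⟩
    refine ⟨hf.const_smul c, Polynomial.C |c| * p, fun t => ?_⟩
    simpa [abs_mul] using mul_le_mul_of_nonneg_left (hp t) (abs_nonneg c)

theorem abs_eval_le_eval (p : Polynomial ℝ) :
    ∃ q : Polynomial ℝ, ∀ t, |p.eval t| ≤ q.eval t :=
  ⟨p ^ 2 + 1, fun t => by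
    simp only [Polynomial.eval_add, Polynomial.eval_pow, Polynomial.eval_one]
    exact abs_le.2 ⟨by nlinarith [sq_nonneg (p.eval t + 1)], by nlinarith [sq_nonneg (p.eval t - 1)]⟩⟩

/-- Polynomial functions as functions of polynomial growth. -/
def polyGrowth.ofPolynomial : Polynomial ℝ →ₗ[ℝ] polyGrowth where
  toFun p := ⟨fun t => p.eval t, p.continuous, abs_eval_le_eval p⟩
  map_add' p q := by ext t; simp
  map_smul' c p := by ext t; simp

open CompactlySupported in
theorem polyGrowth.mem_of_compactlySupported (f : C_c(ℝ, ℝ)) : (f : ℝ → ℝ) ∈ polyGrowth := by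
  obtain ⟨C, hC⟩ := f.hasCompactSupport.exists_bound_of_continuous f.continuous
  exact ⟨f.continuous, Polynomial.C C, fun t => by simpa using hC t⟩

/-- The piecewise linear cutoff equal to `1` on `[-n, n]` and to `0` off `[-n-1, n+1]`. -/
noncomputable def cutoff (n : ℕ) (t : ℝ) : ℝ := max 0 (min 1 (n + 1 - |t|))

theorem cutoff_nonneg (n : ℕ) (t : ℝ) : 0 ≤ cutoff n t := le_max_left _ _

theorem cutoff_le_one (n : ℕ) (t : ℝ) : cutoff n t ≤ 1 := by simp [cutoff]

theorem continuous_cutoff (n : ℕ) : Continuous (cutoff n) := by unfold cutoff; fun_prop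

theorem cutoff_eq_one {n : ℕ} {t : ℝ} (h : |t| ≤ n) : cutoff n t = 1 := by
  unfold cutoff
  rw [min_eq_left (by linarith), max_eq_right zero_le_one]

theorem hasCompactSupport_cutoff (n : ℕ) : HasCompactSupport (cutoff n) := by
  refine HasCompactSupport.intro (isCompact_Icc (a := -((n : ℝ) + 1)) (b := n + 1)) fun t ht => ?_
  have : (n : ℝ) + 1 < |t| := by
    by_contra h
    exact ht (Set.mem_Icc.2 (abs_le.1 (not_lt.1 h)))
  unfold cutoff
  exact max_eq_left ((min_le_right _ _).trans (by linarith))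

/-- Trades decay in n for a factor t², which polynomial growth can absorb. -/
theorem one_sub_cutoff_le (n : ℕ) (t : ℝ) : 1 - cutoff (n + 1) t ≤ t ^ 2 / (n + 1) ^ 2 := by
  by_cases h : |t| ≤ ((n + 1 : ℕ) : ℝ)
  · rw [cutoff_eq_one h, sub_self]; positivity
  · push Not at h
    push_cast at h
    have h1 : ((n : ℝ) + 1) ^ 2 ≤ t ^ 2 := by
      rw [← sq_abs t]
      exact pow_le_pow_left₀ (by positivity) h.le 2
    have h2 : 1 ≤ t ^ 2 / ((n : ℝ) + 1) ^ 2 := by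
      rw [one_le_div (by positivity)]; exact h1
    linarith [cutoff_nonneg (n + 1) t]

open CompactlySupported in
/-- A positive functional on the functions of polynomial growth is given by a measure. -/
theorem exists_measure_of_nonneg (Λ : polyGrowth →ₗ[ℝ] ℝ)
    (hΛ : ∀ g : polyGrowth, (∀ t, 0 ≤ g.1 t) → 0 ≤ Λ g) :
    ∃ β : Measure ℝ, ∀ g : polyGrowth, Integrable g.1 β ∧ ∫ t, g.1 t ∂β = Λ g := by
  have hmono : ∀ f g : polyGrowth, (∀ t, f.1 t ≤ g.1 t) → Λ f ≤ Λ g := by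
    intro f g h
    have := hΛ (g - f) (fun t => sub_nonneg.2 (h t))
    rwa [map_sub, sub_nonneg] at this
  let ι : C_c(ℝ, ℝ) →ₗ[ℝ] polyGrowth :=
    { toFun := fun f => ⟨f, polyGrowth.mem_of_compactlySupported f⟩
      map_add' := fun f g => rfl
      map_smul' := fun c f => rfl }
  let L : C_c(ℝ, ℝ) →ₚ[ℝ] ℝ := PositiveLinearMap.mk₀ (Λ ∘ₗ ι) (fun f hf => hΛ _ hf)
  let β := RealRMK.rieszMeasure L
  have hβ : ∀ f : C_c(ℝ, ℝ), ∫ t, f t ∂β = Λ (ι f) := fun f => RealRMK.integral_rieszMeasure L f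
  let cut : ℕ → polyGrowth → C_c(ℝ, ℝ) := fun n g =>
    { toFun := fun t => g.1 t * cutoff n t
      continuous_toFun := g.2.1.mul (continuous_cutoff n)
      hasCompactSupport' := (hasCompactSupport_cutoff n).mul_left }
  have hcut : ∀ n g t, cut n g t = g.1 t * cutoff n t := fun n g t => rfl
  have hintpos : ∀ g : polyGrowth, (∀ t, 0 ≤ g.1 t) → Integrable g.1 β := by
    intro g hg
    have hcov : AECover β atTop (fun n : ℕ => Set.Icc (-(n : ℝ)) n) :=
      aecover_Icc (tendsto_neg_atTop_atBot.comp tendsto_natCast_atTop_atTop)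
        tendsto_natCast_atTop_atTop
    refine hcov.integrable_of_integral_bounded_of_nonneg_ae (Λ g)
      (fun n => g.2.1.continuousOn.integrableOn_compact isCompact_Icc)
      (Eventually.of_forall hg) (Eventually.of_forall fun n => ?_)
    have hic : Integrable (cut n g) β :=
      (cut n g).continuous.integrable_of_hasCompactSupport (cut n g).hasCompactSupport
    calc ∫ t in Set.Icc (-(n : ℝ)) n, g.1 t ∂β
        = ∫ t in Set.Icc (-(n : ℝ)) n, cut n g t ∂β := by
          refine setIntegral_congr_fun measurableSet_Icc fun t ht => ?_
          simp only [hcut, cutoff_eq_one (abs_le.2 ht), mul_one]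
      _ ≤ ∫ t, cut n g t ∂β :=
          setIntegral_le_integral hic
            (Eventually.of_forall fun t => mul_nonneg (hg t) (cutoff_nonneg _ _))
      _ = Λ (ι (cut n g)) := hβ _
      _ ≤ Λ g := hmono _ _ fun t => mul_le_of_le_one_right (hg t) (cutoff_le_one _ _)
  have hint : ∀ g : polyGrowth, Integrable g.1 β := by
    intro g
    obtain ⟨hgc, q, hq⟩ := g.2
    exact (hintpos (polyGrowth.ofPolynomial q) fun t => (abs_nonneg _).trans (hq t)).mono'
      hgc.aestronglyMeasurable (Eventually.of_forall hq)
  refine ⟨β, fun g => ⟨hint g, ?_⟩⟩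
  have h1 : Tendsto (fun n : ℕ => ∫ t, cut (n + 1) g t ∂β) atTop (𝓝 (∫ t, g.1 t ∂β)) := by
    refine tendsto_integral_of_dominated_convergence (fun t => |g.1 t|)
      (fun n => (cut _ g).continuous.aestronglyMeasurable) (hint g).abs
      (fun n => Eventually.of_forall fun t => ?_) (Eventually.of_forall fun t => ?_)
    · rw [hcut, Real.norm_eq_abs, abs_mul, abs_of_nonneg (cutoff_nonneg _ _)]
      exact mul_le_of_le_one_right (abs_nonneg _) (cutoff_le_one _ _)
    · obtain ⟨N, hN⟩ := exists_nat_ge |t|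
      refine tendsto_const_nhds.congr' (eventually_atTop.2 ⟨N, fun n hn => ?_⟩)
      simp only [hcut]
      rw [cutoff_eq_one, mul_one]
      push_cast
      have : (N : ℝ) ≤ n := by exact_mod_cast hn
      linarith
  -- No continuity of `Λ` is available. The truncation error lies between ±Q/(n+1)² with Q = q·X²,
  -- so positivity alone makes its image under `Λ` tend to 0.
  have h2 : Tendsto (fun n : ℕ => ∫ t, cut (n + 1) g t ∂β) atTop (𝓝 (Λ g)) := by
    obtain ⟨hgc, q, hq⟩ := g.2
    let Q : polyGrowth := polyGrowth.ofPolynomial (q * Polynomial.X ^ 2)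
    have hQ : ∀ t, Q.1 t = q.eval t * t ^ 2 := fun t => by simp [Q, polyGrowth.ofPolynomial]
    rw [tendsto_iff_norm_sub_tendsto_zero]
    have hlim : Tendsto (fun n : ℕ => (1 / ((n : ℝ) + 1)) ^ 2 * Λ Q) atTop (𝓝 0) := by
      simpa using (tendsto_one_div_add_atTop_nhds_zero_nat.pow 2).mul_const (Λ Q)
    refine squeeze_zero (fun n => norm_nonneg _) (fun n => ?_) hlim
    have hb : ∀ t, |g.1 t * cutoff (n + 1) t - g.1 t| ≤ (1 / ((n : ℝ) + 1)) ^ 2 * Q.1 t := by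
      intro t
      have h0 : 0 ≤ 1 - cutoff (n + 1) t := sub_nonneg.2 (cutoff_le_one _ _)
      rw [show g.1 t * cutoff (n + 1) t - g.1 t = -(g.1 t * (1 - cutoff (n + 1) t)) by ring,
        abs_neg, abs_mul, abs_of_nonneg h0, hQ]
      calc |g.1 t| * (1 - cutoff (n + 1) t) ≤ q.eval t * (t ^ 2 / (n + 1) ^ 2) :=
            mul_le_mul (hq t) (one_sub_cutoff_le n t) h0 ((abs_nonneg _).trans (hq t))
        _ = _ := by field_simp
    rw [hβ, ← map_sub, Real.norm_eq_abs, abs_le]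
    constructor
    · have := hmono (-((1 / ((n : ℝ) + 1)) ^ 2 • Q)) (ι (cut (n + 1) g) - g)
        (fun t => (abs_le.1 (hb t)).1)
      simpa using this
    · have := hmono (ι (cut (n + 1) g) - g) ((1 / ((n : ℝ) + 1)) ^ 2 • Q)
        (fun t => (abs_le.1 (hb t)).2)
      simpa using this
  exact tendsto_nhds_unique h1 h2

/-! ### Polynomial majorants under determinacy -/

theorem HasMoments.integrable_eval {α : Measure ℝ} (hα : HasMoments α) (p : Polynomial ℝ) :
    Integrable (fun t => p.eval t) α := by
  simp only [Polynomial.eval_eq_sum_range]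
  exact integrable_finsetSum _ fun n _ => (hα n).const_mul _

theorem HasMoments.integrable_of_mem_polyGrowth {α : Measure ℝ} (hα : HasMoments α) {g : ℝ → ℝ}
    (hg : g ∈ polyGrowth) : Integrable g α := by
  obtain ⟨hgc, q, hq⟩ := hg
  exact (hα.integrable_eval q).mono' hgc.aestronglyMeasurable (Eventually.of_forall hq)

/-- If all polynomial majorants of g had integral at least ∫ g + ε, the moment functional could be
extended positively with the false value ∫ g + ε at g. Its representing measure would share the
moments of α, yet differ from α. -/
theorem HamburgerDeterminate.exists_polynomial_ge {α : Measure ℝ} (hα : HamburgerDeterminate α)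
    {g : ℝ → ℝ} (hg : g ∈ polyGrowth) {ε : ℝ} (hε : 0 < ε) :
    ∃ q : Polynomial ℝ, (∀ t, g t ≤ q.eval t) ∧ ∫ t, q.eval t ∂α < ∫ t, g t ∂α + ε := by
  by_contra! hcon
  let G : polyGrowth := ⟨g, hg⟩
  let I : polyGrowth →ₗ[ℝ] ℝ :=
    { toFun := fun f => ∫ t, f.1 t ∂α
      map_add' := fun f f' => integral_add (hα.1.integrable_of_mem_polyGrowth f.2)
        (hα.1.integrable_of_mem_polyGrowth f'.2)
      map_smul' := fun c f => integral_const_mul c _ }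
  have hI : ∀ f, I f = ∫ t, f.1 t ∂α := fun f => rfl
  let f : polyGrowth →ₗ.[ℝ] ℝ :=
    ⟨LinearMap.range polyGrowth.ofPolynomial, I.domRestrict _⟩
  have hGf : G ∉ f.domain := by
    rintro ⟨q, hq⟩
    have hq' : ∀ t, q.eval t = g t := fun t => congrFun (congrArg Subtype.val hq) t
    have := hcon q fun t => (hq' t).ge
    simp only [hq'] at this
    linarith
  let F := f.supSpanSingleton G (I G + ε) hGf
  have hF : ∀ (p : Polynomial ℝ) (s : ℝ) (h), F ⟨polyGrowth.ofPolynomial p + s • G, h⟩ =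
      I (polyGrowth.ofPolynomial p) + s * (I G + ε) := fun p s h =>
    LinearPMap.supSpanSingleton_apply_mk f G _ hGf _ ⟨p, rfl⟩ s
  let cone : PointedCone ℝ polyGrowth :=
    { carrier := {f | ∀ t, 0 ≤ f.1 t}
      add_mem' := fun {a b} ha hb t => add_nonneg (ha t) (hb t)
      zero_mem' := fun t => le_rfl
      smul_mem' := fun c a ha t => mul_nonneg c.2 (ha t) }
  obtain ⟨Λ, hΛF, hΛ⟩ := riesz_extension cone F (by
    rintro ⟨x, hx⟩ hxc
    obtain ⟨_, ⟨p, rfl⟩, _, hy, rfl⟩ := Submodule.mem_sup.1 hx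
    obtain ⟨s, rfl⟩ := Submodule.mem_span_singleton.1 hy
    rw [hF]
    have hpos : ∀ t, 0 ≤ p.eval t + s * g t := hxc
    have hint : 0 ≤ I (polyGrowth.ofPolynomial p) + s * I G := by
      rw [← smul_eq_mul, ← map_smul, ← map_add]
      exact integral_nonneg hpos
    -- For s ≥ 0 the inflated value only helps. For s < 0, p/(-s) is a majorant of g, and its
    -- integral is bounded below by `hcon`.
    rcases le_or_gt 0 s with hs | hs
    · nlinarith [mul_nonneg hs hε.le]
    · have h1 := hcon (Polynomial.C (-s)⁻¹ * p) fun t => by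
        rw [Polynomial.eval_mul, Polynomial.eval_C, inv_mul_eq_div, le_div_iff₀ (by linarith)]
        linarith [hpos t]
      simp only [Polynomial.eval_mul, Polynomial.eval_C, integral_const_mul] at h1
      rw [inv_mul_eq_div, le_div_iff₀ (by linarith)] at h1
      have h2 : I (polyGrowth.ofPolynomial p) = ∫ t, p.eval t ∂α := rfl
      have h3 : I G = ∫ t, g t ∂α := rfl
      rw [h2, h3]
      linarith) (by
    intro y
    obtain ⟨-, q, hq⟩ := y.2
    refine ⟨⟨polyGrowth.ofPolynomial q, Submodule.mem_sup_left ⟨q, rfl⟩⟩, fun t => ?_⟩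
    have := (abs_le.1 (hq t)).1
    change 0 ≤ q.eval t + y.1 t
    linarith)
  have hΛp : ∀ p, Λ (polyGrowth.ofPolynomial p) = ∫ t, p.eval t ∂α := by
    intro p
    have h := hF p 0 (Submodule.mem_sup.2
      ⟨_, LinearMap.mem_range_self _ p, _, Submodule.mem_span_singleton.2 ⟨0, rfl⟩, rfl⟩)
    rw [← hΛF, zero_mul, add_zero] at h
    simp only [zero_smul, add_zero] at h
    exact h
  have hΛG : Λ G = ∫ t, g t ∂α + ε := by
    have h := hF 0 1 (Submodule.mem_sup.2
      ⟨_, LinearMap.mem_range_self _ 0, _, Submodule.mem_span_singleton.2 ⟨1, rfl⟩, rfl⟩)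
    rw [← hΛF] at h
    simpa [hI] using h
  obtain ⟨β, hβ⟩ := exists_measure_of_nonneg Λ hΛ
  have hβα : β = α := by
    have hX : ∀ n : ℕ, (polyGrowth.ofPolynomial (Polynomial.X ^ n)).1 = fun t => t ^ n := by
      intro n; ext t; simp [polyGrowth.ofPolynomial]
    refine hα.2 β (fun n => ?_) (fun n => ?_)
    · have := (hβ (polyGrowth.ofPolynomial (Polynomial.X ^ n))).1
      rwa [hX] at this
    · have := (hβ (polyGrowth.ofPolynomial (Polynomial.X ^ n))).2
      rw [hX, hΛp] at this
      simpa using this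
  have := (hβ G).2
  rw [hβα, hΛG] at this
  change ∫ t, g t ∂α = _ at this
  linarith

/-! ### Polynomials of small norm with a prescribed value at a non-real point -/

theorem eval_map_conj (S : Polynomial ℂ) (z : ℂ) :
    (S.map (starRingEnd ℂ)).eval z = (starRingEnd ℂ) (S.eval ((starRingEnd ℂ) z)) := by
  rw [← Complex.conj_conj z, Polynomial.eval_map_apply, Complex.conj_conj]

theorem ofReal_sub_ne_zero {z : ℂ} (hz : z.im ≠ 0) (t : ℝ) : (t : ℂ) - z ≠ 0 := by
  intro h
  apply hz
  have := congrArg Complex.im h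
  simpa using this

theorem abs_im_le_norm_ofReal_sub (z : ℂ) (t : ℝ) : |z.im| ≤ ‖(t : ℂ) - z‖ := by
  simpa using Complex.abs_im_le_norm ((t : ℂ) - z)

theorem norm_ofReal_sub_conj (z : ℂ) (t : ℝ) :
    ‖(t : ℂ) - (starRingEnd ℂ) z‖ = ‖(t : ℂ) - z‖ := by
  rw [← Complex.norm_conj ((t : ℂ) - z), map_sub, Complex.conj_ofReal]

theorem norm_ofReal_sub_sq (z : ℂ) (t : ℝ) :
    ‖(t : ℂ) - z‖ ^ 2 = (t - z.re) ^ 2 + z.im ^ 2 := by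
  rw [← Complex.normSq_eq_norm_sq, Complex.normSq_apply]
  simp
  ring

theorem continuous_div_norm_sq {f : ℝ → ℝ} (hf : Continuous f) {z : ℂ} (hz : z.im ≠ 0) :
    Continuous fun t : ℝ => f t / ‖(t : ℂ) - z‖ ^ 2 :=
  hf.div (by fun_prop) fun t => by
    have := ofReal_sub_ne_zero hz t
    positivity

/-- Take a polynomial q ≥ c/|t - z|² with nearly the same integral, and factor q·|t - z|² - c ≥ 0 as
S·S*, where S* has the conjugate coefficients. The quadratic |t - z|² extends to a polynomial
vanishing at z, which leaves -c there. -/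
theorem HamburgerDeterminate.exists_eval_mul_conj_eval_eq {α : Measure ℝ}
    (hα : HamburgerDeterminate α) {z : ℂ} (hz : z.im ≠ 0) (c : ℝ) {ε : ℝ} (hε : 0 < ε) :
    ∃ S : Polynomial ℂ,
      S.eval z * (starRingEnd ℂ) (S.eval ((starRingEnd ℂ) z)) = -c ∧
      ‖S.eval ((starRingEnd ℂ) z)‖ ≤ ‖S.eval z‖ ∧
      Integrable (fun t : ℝ => ‖S.eval (t : ℂ)‖ ^ 2 / ‖(t : ℂ) - z‖ ^ 2) α ∧
      ∫ t : ℝ, ‖S.eval (t : ℂ)‖ ^ 2 / ‖(t : ℂ) - z‖ ^ 2 ∂α < ε := by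
  have him : 0 < z.im ^ 2 := by positivity
  have hg : (fun t : ℝ => c / ‖(t : ℂ) - z‖ ^ 2) ∈ polyGrowth := by
    refine ⟨continuous_div_norm_sq continuous_const hz, Polynomial.C (|c| / z.im ^ 2), fun t => ?_⟩
    rw [abs_div, Polynomial.eval_C, abs_of_nonneg (sq_nonneg ‖(t : ℂ) - z‖),
      norm_ofReal_sub_sq]
    gcongr
    nlinarith [sq_nonneg (t - z.re)]
  obtain ⟨q, hq, hqε⟩ := hα.exists_polynomial_ge hg hε
  let N : Polynomial ℝ := (Polynomial.X - Polynomial.C z.re) ^ 2 + Polynomial.C (z.im ^ 2)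
  have hN : ∀ t : ℝ, N.eval t = ‖(t : ℂ) - z‖ ^ 2 := fun t => by
    simp [N, norm_ofReal_sub_sq]
  have hpos : ∀ t : ℝ, 0 < ‖(t : ℂ) - z‖ ^ 2 := fun t => by
    have := ofReal_sub_ne_zero hz t
    positivity
  have hNz : (N.map (algebraMap ℝ ℂ)).eval z = 0 := by
    simp only [N, Polynomial.map_add, Polynomial.map_pow, Polynomial.map_sub, Polynomial.map_X,
      Polynomial.map_C, Polynomial.eval_add, Polynomial.eval_pow, Polynomial.eval_sub,
      Polynomial.eval_X, Polynomial.eval_C, Complex.coe_algebraMap]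
    have : z - z.re = z.im * Complex.I := by
      conv_lhs => enter [1]; rw [← Complex.re_add_im z]
      ring
    rw [this, mul_pow, Complex.I_sq]
    push_cast
    ring
  obtain ⟨S, hS⟩ := exists_eq_mul_map_conj_of_eval_nonneg (q * N - Polynomial.C c) fun t => by
    have := hq t
    rw [div_le_iff₀ (hpos t)] at this
    simp only [Polynomial.eval_sub, Polynomial.eval_mul, Polynomial.eval_C, hN]
    linarith
  have hSz : S.eval z * (starRingEnd ℂ) (S.eval ((starRingEnd ℂ) z)) = -c := by
    have := congrArg (Polynomial.eval z) hS
    rw [Polynomial.eval_mul, eval_map_conj] at this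
    rw [← this]
    simp [hNz]
  have hSt : ∀ t : ℝ, ‖S.eval (t : ℂ)‖ ^ 2 / ‖(t : ℂ) - z‖ ^ 2 =
      q.eval t - c / ‖(t : ℂ) - z‖ ^ 2 := by
    intro t
    have := congrArg (Polynomial.eval (t : ℂ)) hS
    rw [Polynomial.eval_mul, eval_map_conj, Complex.conj_ofReal, Complex.mul_conj,
      Complex.normSq_eq_norm_sq, ← Complex.coe_algebraMap, Polynomial.eval_map_apply,
      Complex.coe_algebraMap, Complex.ofReal_inj] at this
    rw [← this, eq_comm, eq_div_iff (hpos t).ne']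
    simp only [Polynomial.eval_sub, Polynomial.eval_mul, Polynomial.eval_C, hN]
    rw [sub_mul, div_mul_cancel₀ _ (hpos t).ne']
  have hint := (hα.1.integrable_eval q).sub (hα.1.integrable_of_mem_polyGrowth hg)
  have hlt : ∫ t : ℝ, ‖S.eval (t : ℂ)‖ ^ 2 / ‖(t : ℂ) - z‖ ^ 2 ∂α < ε := by
    simp only [hSt]
    rw [integral_sub (hα.1.integrable_eval q) (hα.1.integrable_of_mem_polyGrowth hg)]
    linarith
  have hint' : Integrable (fun t : ℝ => ‖S.eval (t : ℂ)‖ ^ 2 / ‖(t : ℂ) - z‖ ^ 2) α := by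
    simp only [hSt]
    exact hint
  -- Conjugating the coefficients swaps the moduli at z and z̄ and changes nothing on the real line.
  rcases le_total ‖S.eval ((starRingEnd ℂ) z)‖ ‖S.eval z‖ with h | h
  · exact ⟨S, hSz, h, hint', hlt⟩
  · refine ⟨S.map (starRingEnd ℂ), ?_, ?_, ?_, ?_⟩
    · rw [eval_map_conj, eval_map_conj, Complex.conj_conj, Complex.conj_conj, mul_comm]
      exact hSz
    · simpa [eval_map_conj] using h
    · simpa [eval_map_conj] using hint'
    · simpa [eval_map_conj] using hlt

/-- A combination S - lT with |l| ≤ 1 vanishes at z̄. Dividing it by X - z̄ turns the weighted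
bounds on S and T into an unweighted bound on the quotient. -/
theorem exists_eval_eq_one_of_pair {α : Measure ℝ} {z : ℂ} (hz : z.im ≠ 0) {c ε : ℝ}
    (hc : c ^ 2 = 1) {S T : Polynomial ℂ}
    (hS : S.eval z * (starRingEnd ℂ) (S.eval ((starRingEnd ℂ) z)) = -c)
    (hT : T.eval z * (starRingEnd ℂ) (T.eval ((starRingEnd ℂ) z)) = c)
    (hSS : ‖S.eval ((starRingEnd ℂ) z)‖ ≤ ‖S.eval z‖) (hTS : ‖T.eval z‖ ≤ ‖S.eval z‖)
    (hSi : Integrable (fun t : ℝ => ‖S.eval (t : ℂ)‖ ^ 2 / ‖(t : ℂ) - z‖ ^ 2) α)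
    (hTi : Integrable (fun t : ℝ => ‖T.eval (t : ℂ)‖ ^ 2 / ‖(t : ℂ) - z‖ ^ 2) α)
    (hSε : ∫ t : ℝ, ‖S.eval (t : ℂ)‖ ^ 2 / ‖(t : ℂ) - z‖ ^ 2 ∂α < ε)
    (hTε : ∫ t : ℝ, ‖T.eval (t : ℂ)‖ ^ 2 / ‖(t : ℂ) - z‖ ^ 2 ∂α < ε) :
    ∃ U : Polynomial ℂ, U.eval z = 1 ∧ Integrable (fun t : ℝ => ‖U.eval (t : ℂ)‖ ^ 2) α ∧
      ∫ t : ℝ, ‖U.eval (t : ℂ)‖ ^ 2 ∂α ≤ 16 * z.im ^ 2 * ε := by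
  set w := (starRingEnd ℂ) z with hw
  set s := S.eval z
  set s' := S.eval w
  set r := T.eval z
  set r' := T.eval w
  have hc0 : c ≠ 0 := by rintro rfl; norm_num at hc
  have hcC : (c : ℂ) ≠ 0 := by exact_mod_cast hc0
  have hs0 : s ≠ 0 := fun h => hcC (by rw [h, zero_mul] at hS; exact (neg_eq_zero.1 hS.symm))
  have hr'0 : r' ≠ 0 := fun h => hcC (by rw [h, map_zero, mul_zero] at hT; exact hT.symm)
  have hs1 : 1 ≤ ‖s‖ := by
    have h := congrArg norm hS
    rw [norm_mul, Complex.norm_conj, norm_neg, Complex.norm_real, Real.norm_eq_abs] at h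
    have habs : |c| = 1 := by rwa [← sq_eq_sq₀ (abs_nonneg _) zero_le_one, sq_abs, one_pow]
    rw [habs] at h
    nlinarith [norm_nonneg s, norm_nonneg s']
  have hSc : (starRingEnd ℂ) s * s' = -c := by
    have := congrArg (starRingEnd ℂ) hS
    simpa using this
  have hTc : (starRingEnd ℂ) r * r' = c := by
    have := congrArg (starRingEnd ℂ) hT
    simpa using this
  have hcs0 : (starRingEnd ℂ) s ≠ 0 := by simpa using hs0
  set l := s' / r' with hl
  have hl' : l = -((starRingEnd ℂ) r / (starRingEnd ℂ) s) := by
    rw [hl, ← neg_div, div_eq_div_iff hr'0 hcs0]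
    linear_combination hSc + hTc
  have hlnorm : ‖l‖ ≤ 1 := by
    rw [hl', norm_neg, norm_div, Complex.norm_conj, Complex.norm_conj]
    exact div_le_one_of_le₀ hTS (norm_nonneg _)
  set P := S - Polynomial.C l * T with hP
  have hPw : P.IsRoot w := by
    simp only [hP, Polynomial.IsRoot, Polynomial.eval_sub, Polynomial.eval_mul, Polynomial.eval_C]
    change s' - l * r' = 0
    rw [hl, div_mul_cancel₀ _ hr'0, sub_self]
  -- The opposite signs in `hS` and `hT` make the two contributions add up to |s|² + |r|² instead of
  -- cancelling.
  have hPz : 1 ≤ ‖P.eval z‖ := by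
    have h1 : P.eval z = ((‖s‖ ^ 2 + ‖r‖ ^ 2 : ℝ) : ℂ) / (starRingEnd ℂ) s := by
      simp only [hP, Polynomial.eval_sub, Polynomial.eval_mul, Polynomial.eval_C]
      change s - l * r = _
      rw [hl', eq_div_iff hcs0]
      push_cast
      rw [← Complex.mul_conj', ← Complex.mul_conj']
      field_simp
      ring
    rw [h1, norm_div, Complex.norm_conj, Complex.norm_real, Real.norm_eq_abs,
      abs_of_nonneg (by positivity), one_le_div (by linarith)]
    nlinarith [sq_nonneg ‖r‖]
  obtain ⟨U, hU⟩ := Polynomial.dvd_iff_isRoot.2 hPw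
  have hzw : ‖z - w‖ = 2 * |z.im| := by
    rw [hw, Complex.sub_conj]
    simp
  have hUz : 1 ≤ ‖U.eval z‖ * (2 * |z.im|) := by
    rw [hU, Polynomial.eval_mul, norm_mul] at hPz
    simp only [Polynomial.eval_sub, Polynomial.eval_X, Polynomial.eval_C, hzw] at hPz
    linarith
  have hUz0 : U.eval z ≠ 0 := by
    intro h
    rw [h, norm_zero, zero_mul] at hUz
    linarith
  -- The factor 8 is (2|Im z|)² from normalising at z, times 2 from squaring a sum.
  have hbound : ∀ t : ℝ, ‖(Polynomial.C (U.eval z)⁻¹ * U).eval (t : ℂ)‖ ^ 2 ≤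
      8 * z.im ^ 2 * (‖S.eval (t : ℂ)‖ ^ 2 / ‖(t : ℂ) - z‖ ^ 2 +
        ‖T.eval (t : ℂ)‖ ^ 2 / ‖(t : ℂ) - z‖ ^ 2) := by
    intro t
    have htz : 0 < ‖(t : ℂ) - z‖ := norm_pos_iff.2 (ofReal_sub_ne_zero hz t)
    have h1 : ‖U.eval (t : ℂ)‖ * ‖(t : ℂ) - z‖ ≤ ‖S.eval (t : ℂ)‖ + ‖T.eval (t : ℂ)‖ := by
      have h2 := congrArg (fun Q => ‖Q.eval (t : ℂ)‖) hU
      simp only [hP, Polynomial.eval_mul, Polynomial.eval_sub, Polynomial.eval_X,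
        Polynomial.eval_C, norm_mul] at h2
      rw [hw, norm_ofReal_sub_conj] at h2
      rw [mul_comm, ← h2]
      refine (norm_sub_le _ _).trans ?_
      rw [norm_mul]
      gcongr
      exact mul_le_of_le_one_left (norm_nonneg _) hlnorm
    have h2 : ‖(U.eval z)⁻¹‖ ≤ 2 * |z.im| := by
      rw [norm_inv]
      exact inv_le_of_inv_le₀ (by positivity) (by
        rw [inv_le_iff_one_le_mul₀ (by positivity)]; linarith)
    have h3 : (‖U.eval (t : ℂ)‖ * ‖(t : ℂ) - z‖) ^ 2 ≤
        2 * (‖S.eval (t : ℂ)‖ ^ 2 + ‖T.eval (t : ℂ)‖ ^ 2) :=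
      (pow_le_pow_left₀ (by positivity) h1 2).trans (add_sq_le)
    rw [Polynomial.eval_mul, Polynomial.eval_C, norm_mul, mul_pow, ← add_div]
    calc ‖(U.eval z)⁻¹‖ ^ 2 * ‖U.eval (t : ℂ)‖ ^ 2
        ≤ (2 * |z.im|) ^ 2 * (2 * (‖S.eval (t : ℂ)‖ ^ 2 + ‖T.eval (t : ℂ)‖ ^ 2) /
            ‖(t : ℂ) - z‖ ^ 2) := by
          gcongr
          rw [le_div_iff₀ (by positivity), ← mul_pow]
          exact h3
      _ = _ := by rw [mul_pow, sq_abs]; ring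
  have hint := (hSi.add hTi).const_mul (8 * z.im ^ 2)
  have hUi : Integrable (fun t : ℝ => ‖(Polynomial.C (U.eval z)⁻¹ * U).eval (t : ℂ)‖ ^ 2) α :=
    hint.mono' (Continuous.aestronglyMeasurable (by fun_prop))
      (Eventually.of_forall fun t => by
        rw [Real.norm_eq_abs, abs_of_nonneg (sq_nonneg _)]
        exact hbound t)
  refine ⟨Polynomial.C (U.eval z)⁻¹ * U, by simp [hUz0], hUi, ?_⟩
  refine (integral_mono hUi hint hbound).trans ?_
  simp only [Pi.add_apply]
  rw [integral_const_mul, integral_add hSi hTi]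
  nlinarith [sq_nonneg z.im, mul_le_mul_of_nonneg_left (add_le_add hSε.le hTε.le) (sq_nonneg z.im)]

/-- For a determinate measure, there are polynomials with value `1` at a given non-real point and
with arbitrarily small `L²` norm. -/
theorem HamburgerDeterminate.exists_eval_eq_one {α : Measure ℝ} (hα : HamburgerDeterminate α)
    {z : ℂ} (hz : z.im ≠ 0) {ε : ℝ} (hε : 0 < ε) :
    ∃ U : Polynomial ℂ, U.eval z = 1 ∧ Integrable (fun t : ℝ => ‖U.eval (t : ℂ)‖ ^ 2) α ∧
      ∫ t : ℝ, ‖U.eval (t : ℂ)‖ ^ 2 ∂α ≤ ε := by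
  have him : 0 < 16 * z.im ^ 2 := by positivity
  obtain ⟨S, hS, hSS, hSi, hSε⟩ := hα.exists_eval_mul_conj_eval_eq hz 1 (div_pos hε him)
  obtain ⟨T, hT, hTT, hTi, hTε⟩ := hα.exists_eval_mul_conj_eval_eq hz (-1) (div_pos hε him)
  have hmul : 16 * z.im ^ 2 * (ε / (16 * z.im ^ 2)) = ε := mul_div_cancel₀ _ him.ne'
  rcases le_total ‖T.eval z‖ ‖S.eval z‖ with h | h
  · obtain ⟨U, h1, h2, h3⟩ := exists_eval_eq_one_of_pair hz (c := 1) (by norm_num) hS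
      (by simpa using hT) hSS h hSi hTi hSε hTε
    exact ⟨U, h1, h2, h3.trans_eq hmul⟩
  · obtain ⟨U, h1, h2, h3⟩ := exists_eval_eq_one_of_pair hz (c := -1) (by norm_num) hT
      (by simpa using hS) hTT h hTi hSi hTε hSε
    exact ⟨U, h1, h2, h3.trans_eq hmul⟩

/-! ### Orthogonality to the monomials of positive degree -/

theorem norm_eval_sq_mem_polyGrowth (P : Polynomial ℂ) :
    (fun t : ℝ => ‖P.eval (t : ℂ)‖ ^ 2) ∈ polyGrowth := by
  obtain ⟨q, hq⟩ : ∃ q : Polynomial ℝ, ∀ t : ℝ, ‖P.eval (t : ℂ)‖ ≤ q.eval t := by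
    induction P using Polynomial.induction_on' with
    | add P Q hP hQ =>
      obtain ⟨p, hp⟩ := hP
      obtain ⟨q, hq⟩ := hQ
      refine ⟨p + q, fun t => ?_⟩
      rw [Polynomial.eval_add, Polynomial.eval_add]
      exact (norm_add_le _ _).trans (add_le_add (hp t) (hq t))
    | monomial n a =>
      obtain ⟨q, hq⟩ := abs_eval_le_eval (Polynomial.X ^ n : Polynomial ℝ)
      refine ⟨Polynomial.C ‖a‖ * q, fun t => ?_⟩
      have := mul_le_mul_of_nonneg_left (hq t) (norm_nonneg a)
      simpa using this
  refine ⟨by fun_prop, q ^ 2, fun t => ?_⟩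
  rw [abs_of_nonneg (sq_nonneg _), Polynomial.eval_pow]
  exact pow_le_pow_left₀ (norm_nonneg _) (hq t) 2

theorem HasMoments.integrable_mul_eval {α : Measure ℝ} (hα : HasMoments α) {ψ : ℝ → ℂ}
    (hψ : MemLp ψ 2 α) (P : Polynomial ℂ) : Integrable (fun t : ℝ => ψ t * P.eval (t : ℂ)) α := by
  have hP : MemLp (fun t : ℝ => P.eval (t : ℂ)) 2 α := by
    rw [memLp_two_iff_integrable_sq_norm (Continuous.aestronglyMeasurable (by fun_prop))]
    exact hα.integrable_of_mem_polyGrowth (norm_eval_sq_mem_polyGrowth P)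
  exact hψ.integrable_mul hP

theorem integral_mul_eval_eq_zero {α : Measure ℝ} {f : ℝ → ℂ}
    (hf : ∀ n : ℕ, Integrable (fun t : ℝ => f t * (t : ℂ) ^ n) α)
    (h0 : ∀ n : ℕ, ∫ t : ℝ, f t * (t : ℂ) ^ n ∂α = 0) (P : Polynomial ℂ) :
    ∫ t : ℝ, f t * P.eval (t : ℂ) ∂α = 0 := by
  simp only [Polynomial.eval_eq_sum_range, Finset.mul_sum]
  rw [integral_finsetSum]
  · refine Finset.sum_eq_zero fun n _ => ?_
    simp only [mul_left_comm (f _)]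
    rw [integral_const_mul, h0, mul_zero]
  · intro n _
    simp only [mul_left_comm (f _)]
    exact (hf n).const_mul _

theorem HamburgerDeterminate.integral_div_eq_zero {α : Measure ℝ} (hα : HamburgerDeterminate α)
    {ψ : ℝ → ℂ} (hψ : MemLp ψ 2 α) (h0 : ∀ n : ℕ, ∫ t : ℝ, ψ t * (t : ℂ) ^ (n + 1) ∂α = 0)
    {z : ℂ} (hz : z.im ≠ 0) : ∫ t : ℝ, ψ t * t / ((t : ℂ) - z) ∂α = 0 := by
  have hpow : ∀ n : ℕ, Integrable (fun t : ℝ => ψ t * t * (t : ℂ) ^ n) α := by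
    intro n
    have := hα.1.integrable_mul_eval hψ (Polynomial.X ^ (n + 1))
    simpa [pow_succ', mul_assoc] using this
  have hpoly : ∀ P : Polynomial ℂ, ∫ t : ℝ, ψ t * t * P.eval (t : ℂ) ∂α = 0 :=
    integral_mul_eval_eq_zero hpow fun n => by simpa [pow_succ', mul_assoc] using h0 n
  have hpolyi : ∀ P : Polynomial ℂ, Integrable (fun t : ℝ => ψ t * t * P.eval (t : ℂ)) α := by
    intro P
    have := hα.1.integrable_mul_eval hψ (Polynomial.X * P)
    simpa [mul_assoc] using this
  set M : ℝ := 1 + ‖z‖ / |z.im| with hM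
  have him : 0 < |z.im| := abs_pos.2 hz
  have hMpos : 0 < M := by positivity
  have hMb : ∀ t : ℝ, ‖(t : ℂ) / ((t : ℂ) - z)‖ ≤ M := by
    intro t
    have hne := ofReal_sub_ne_zero hz t
    have : (t : ℂ) / ((t : ℂ) - z) = 1 + z / ((t : ℂ) - z) := by field_simp; ring
    rw [this]
    refine (norm_add_le _ _).trans ?_
    rw [norm_one, norm_div, hM]
    gcongr
    exact abs_im_le_norm_ofReal_sub z t
  have hψ2 : Integrable (fun t => ‖ψ t‖ ^ 2) α :=
    (memLp_two_iff_integrable_sq_norm hψ.1).1 hψ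
  set A : ℝ := ∫ t, ‖ψ t‖ ^ 2 ∂α with hA
  have hA0 : 0 ≤ A := integral_nonneg fun t => sq_nonneg _
  rw [← norm_le_zero_iff]
  refine le_of_forall_pos_le_add fun ε hε => ?_
  rw [zero_add]
  -- Chosen so that the final bound M(δA/2 + δ/2) equals ε/2.
  set δ : ℝ := ε / (M * (A + 1)) with hδ
  have hδpos : 0 < δ := by positivity
  obtain ⟨U, hU1, hUi, hUδ⟩ := hα.exists_eval_eq_one hz (sq_pos_of_pos hδpos)
  obtain ⟨W, hW⟩ := Polynomial.dvd_iff_isRoot.2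
    (show (U - 1).IsRoot z by simp [Polynomial.IsRoot, hU1])
  -- Since U - 1 = (X - z)W, the second term integrates to 0 by hypothesis; the first is small
  -- because t/(t - z) is bounded and U is small in L².
  have hUW : ∀ t : ℝ, ψ t * t / ((t : ℂ) - z) =
      ψ t * ((t : ℂ) / ((t : ℂ) - z)) * U.eval (t : ℂ) - ψ t * t * W.eval (t : ℂ) := by
    intro t
    have hne := ofReal_sub_ne_zero hz t
    have h1 := congrArg (Polynomial.eval (t : ℂ)) hW
    simp only [Polynomial.eval_sub, Polynomial.eval_one, Polynomial.eval_mul, Polynomial.eval_X,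
      Polynomial.eval_C] at h1
    field_simp
    linear_combination (-ψ t * t) * h1
  have hb : ∀ t : ℝ, ‖ψ t * ((t : ℂ) / ((t : ℂ) - z)) * U.eval (t : ℂ)‖ ≤
      M * (δ / 2 * ‖ψ t‖ ^ 2 + δ⁻¹ / 2 * ‖U.eval (t : ℂ)‖ ^ 2) := by
    intro t
    rw [norm_mul, norm_mul]
    have h1 : ‖ψ t‖ * ‖U.eval (t : ℂ)‖ ≤
        δ / 2 * ‖ψ t‖ ^ 2 + δ⁻¹ / 2 * ‖U.eval (t : ℂ)‖ ^ 2 := by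
      have h3 : δ / 2 * ‖ψ t‖ ^ 2 + δ⁻¹ / 2 * ‖U.eval (t : ℂ)‖ ^ 2 -
          ‖ψ t‖ * ‖U.eval (t : ℂ)‖ = δ⁻¹ / 2 * (δ * ‖ψ t‖ - ‖U.eval (t : ℂ)‖) ^ 2 := by
        field_simp
        ring
      have h4 : 0 ≤ δ⁻¹ / 2 * (δ * ‖ψ t‖ - ‖U.eval (t : ℂ)‖) ^ 2 := by positivity
      linarith
    calc ‖ψ t‖ * ‖(t : ℂ) / ((t : ℂ) - z)‖ * ‖U.eval (t : ℂ)‖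
        = ‖(t : ℂ) / ((t : ℂ) - z)‖ * (‖ψ t‖ * ‖U.eval (t : ℂ)‖) := by ring
      _ ≤ M * _ := mul_le_mul (hMb t) h1 (by positivity) hMpos.le
  have hbi := ((hψ2.const_mul (δ / 2)).add (hUi.const_mul (δ⁻¹ / 2))).const_mul M
  have hcont : Continuous fun t : ℝ => (t : ℂ) / ((t : ℂ) - z) :=
    Continuous.div (by fun_prop) (by fun_prop) (ofReal_sub_ne_zero hz)
  have hUint : Integrable
      (fun t : ℝ => ψ t * ((t : ℂ) / ((t : ℂ) - z)) * U.eval (t : ℂ)) α :=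
    hbi.mono' ((hψ.1.mul hcont.aestronglyMeasurable).mul
      (Continuous.aestronglyMeasurable (by fun_prop))) (Eventually.of_forall hb)
  simp only [hUW]
  rw [integral_sub hUint (hpolyi W), hpoly, sub_zero]
  refine (norm_integral_le_of_norm_le hbi (Eventually.of_forall hb)).trans ?_
  simp only [Pi.add_apply]
  rw [integral_const_mul, integral_add (hψ2.const_mul _) (hUi.const_mul _), integral_const_mul,
    integral_const_mul, ← hA]
  have h5 : δ⁻¹ / 2 * ∫ t : ℝ, ‖U.eval (t : ℂ)‖ ^ 2 ∂α ≤ δ / 2 := by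
    calc δ⁻¹ / 2 * ∫ t : ℝ, ‖U.eval (t : ℂ)‖ ^ 2 ∂α ≤ δ⁻¹ / 2 * δ ^ 2 := by gcongr
      _ = δ / 2 := by field_simp
  calc M * (δ / 2 * A + δ⁻¹ / 2 * ∫ t : ℝ, ‖U.eval (t : ℂ)‖ ^ 2 ∂α)
      ≤ M * (δ / 2 * A + δ / 2) := by gcongr
    _ = ε / 2 := by rw [hδ]; field_simp
    _ ≤ ε := by linarith

/-! ### Stieltjes inversion -/

theorem hasDerivAt_integral_mul_arctan {α : Measure ℝ} {F : ℝ → ℂ} (hF : Integrable F α) {y : ℝ}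
    (hy : 0 < y) (b : ℝ) :
    HasDerivAt (fun b : ℝ => ∫ t : ℝ, F t * (Real.arctan ((b - t) / y) : ℂ) ∂α)
      (∫ t : ℝ, F t * ((y / ((t - b) ^ 2 + y ^ 2) : ℝ) : ℂ) ∂α) b := by
  have hmeas : ∀ b : ℝ, AEStronglyMeasurable
      (fun t : ℝ => F t * (Real.arctan ((b - t) / y) : ℂ)) α := fun b =>
    hF.1.mul (Continuous.aestronglyMeasurable
      (Complex.continuous_ofReal.comp (Real.continuous_arctan.comp (by fun_prop))))
  refine (hasDerivAt_integral_of_dominated_loc_of_deriv_le (s := Set.univ)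
    (F := fun (b t : ℝ) => F t * (Real.arctan ((b - t) / y) : ℂ))
    (F' := fun (b t : ℝ) => F t * ((y / ((t - b) ^ 2 + y ^ 2) : ℝ) : ℂ))
    (bound := fun t => ‖F t‖ * y⁻¹)
    Filter.univ_mem (Eventually.of_forall hmeas) ?_ ?_ ?_ (hF.norm.mul_const _) ?_).2
  · refine (hF.norm.mul_const (Real.pi / 2)).mono' (hmeas b) (Eventually.of_forall fun t => ?_)
    rw [norm_mul, Complex.norm_real, Real.norm_eq_abs]
    gcongr
    exact abs_le.2 ⟨(Real.neg_pi_div_two_lt_arctan _).le, (Real.arctan_lt_pi_div_two _).le⟩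
  · refine hF.1.mul (Continuous.aestronglyMeasurable (Complex.continuous_ofReal.comp ?_))
    exact Continuous.div (by fun_prop) (by fun_prop) fun t => by positivity
  · refine Eventually.of_forall fun t b _ => ?_
    rw [norm_mul, Complex.norm_real, Real.norm_eq_abs, abs_of_nonneg (by positivity)]
    gcongr
    rw [div_le_iff₀ (by positivity)]
    field_simp
    nlinarith [sq_nonneg (t - b)]
  · refine Eventually.of_forall fun t b _ => ?_
    have h1 : HasDerivAt (fun b : ℝ => Real.arctan ((b - t) / y))
        (y / ((t - b) ^ 2 + y ^ 2)) b := by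
      have h2 : HasDerivAt (fun b : ℝ => (b - t) / y) (1 / y) b :=
        ((hasDerivAt_id b).sub_const t).div_const y
      convert h2.arctan using 1
      field_simp
      ring
    exact h1.ofReal_comp.const_mul (F t)

/-- The Poisson kernel is a multiple of the difference of 1/(t - z) at the conjugate points b ± iy.
-/
theorem integral_mul_poisson_eq_zero {α : Measure ℝ} {F : ℝ → ℂ} (hF : Integrable F α)
    (h0 : ∀ z : ℂ, z.im ≠ 0 → ∫ t : ℝ, F t / ((t : ℂ) - z) ∂α = 0) {y : ℝ} (hy : 0 < y) (b : ℝ) :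
    ∫ t : ℝ, F t * ((y / ((t - b) ^ 2 + y ^ 2) : ℝ) : ℂ) ∂α = 0 := by
  have hint : ∀ z : ℂ, z.im ≠ 0 → Integrable (fun t : ℝ => F t / ((t : ℂ) - z)) α := by
    intro z hz
    refine (hF.norm.mul_const (|z.im|⁻¹)).mono' (hF.1.mul (g := fun t : ℝ => ((t : ℂ) - z)⁻¹)
      (Continuous.aestronglyMeasurable
        (Continuous.inv₀ (by fun_prop) (ofReal_sub_ne_zero hz))))
      (Eventually.of_forall fun t => ?_)
    rw [norm_div, div_eq_mul_inv]
    have := abs_pos.2 hz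
    gcongr
    exact abs_im_le_norm_ofReal_sub z t
  set z : ℂ := b + y * Complex.I with hz
  set w : ℂ := b - y * Complex.I with hw
  have hzi : z.im ≠ 0 := by simp [hz, hy.ne']
  have hwi : w.im ≠ 0 := by simp [hw, hy.ne']
  have key : ∀ t : ℝ, F t * ((y / ((t - b) ^ 2 + y ^ 2) : ℝ) : ℂ) =
      (2 * Complex.I)⁻¹ * (F t / ((t : ℂ) - z) - F t / ((t : ℂ) - w)) := by
    intro t
    have h1 := ofReal_sub_ne_zero hzi t
    have h2 := ofReal_sub_ne_zero hwi t
    have h3 : (((t - b) ^ 2 + y ^ 2 : ℝ) : ℂ) = ((t : ℂ) - z) * ((t : ℂ) - w) := by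
      rw [hz, hw]
      push_cast
      ring_nf
      rw [Complex.I_sq]
      ring
    have h4 : z - w = 2 * Complex.I * y := by rw [hz, hw]; ring
    rw [Complex.ofReal_div, h3, div_sub_div _ _ h1 h2, ← mul_div_assoc, inv_mul_eq_div, div_div,
      div_eq_div_iff (mul_ne_zero h1 h2) (mul_ne_zero (mul_ne_zero h1 h2) (by simp))]
    linear_combination (-(F t) * (((t : ℂ) - z) * ((t : ℂ) - w))) * h4
  simp only [key]
  rw [integral_const_mul, integral_sub (hint z hzi) (hint w hwi), h0 z hzi, h0 w hwi, sub_zero,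
    mul_zero]

theorem integral_mul_arctan_eq {α : Measure ℝ} {F : ℝ → ℂ} (hF : Integrable F α)
    (h0 : ∀ z : ℂ, z.im ≠ 0 → ∫ t : ℝ, F t / ((t : ℂ) - z) ∂α = 0) {y : ℝ} (hy : 0 < y) (a b : ℝ) :
    ∫ t : ℝ, F t * (Real.arctan ((a - t) / y) : ℂ) ∂α =
      ∫ t : ℝ, F t * (Real.arctan ((b - t) / y) : ℂ) ∂α :=
  is_const_of_deriv_eq_zero
    (fun b => (hasDerivAt_integral_mul_arctan hF hy b).differentiableAt)
    (fun b => by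
      rw [(hasDerivAt_integral_mul_arctan hF hy b).deriv,
        integral_mul_poisson_eq_zero hF h0 hy b]) a b

theorem tendsto_integral_mul_arctan {α : Measure ℝ} {F : ℝ → ℂ} (hF : Integrable F α)
    {u : ℕ → ℝ → ℝ} (hu : ∀ n, Continuous (u n)) {g : ℝ → ℝ}
    (hg : ∀ t, Tendsto (fun n => Real.arctan (u n t)) atTop (𝓝 (g t))) :
    Tendsto (fun n => ∫ t : ℝ, F t * (Real.arctan (u n t) : ℂ) ∂α) atTop
      (𝓝 (∫ t : ℝ, F t * (g t : ℂ) ∂α)) := by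
  refine tendsto_integral_of_dominated_convergence (fun t => ‖F t‖ * (Real.pi / 2))
    (fun n => hF.1.mul (Continuous.aestronglyMeasurable
      (Complex.continuous_ofReal.comp (Real.continuous_arctan.comp (hu n)))))
    (hF.norm.mul_const _) (fun n => Eventually.of_forall fun t => ?_)
    (Eventually.of_forall fun t => ?_)
  · rw [norm_mul, Complex.norm_real, Real.norm_eq_abs]
    gcongr
    exact abs_le.2 ⟨(Real.neg_pi_div_two_lt_arctan _).le, (Real.arctan_lt_pi_div_two _).le⟩
  · exact ((Complex.continuous_ofReal.tendsto _).comp (hg t)).const_mul (F t)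

/-- As y tends to 0, arctan((b - t)/y) becomes a step function at b. Its integral does not depend on
b, so it may be compared with base points going to -∞. -/
theorem setIntegral_Iic_eq_zero {α : Measure ℝ} {F : ℝ → ℂ} (hF : Integrable F α)
    (h0 : ∀ z : ℂ, z.im ≠ 0 → ∫ t : ℝ, F t / ((t : ℂ) - z) ∂α = 0) (b : ℝ) :
    ∫ t in Set.Iic b, F t ∂α = 0 := by
  have htop := Real.tendsto_arctan_atTop.mono_right nhdsWithin_le_nhds
  have hbot := Real.tendsto_arctan_atBot.mono_right nhdsWithin_le_nhds
  have hN : Tendsto (fun n : ℕ => (n : ℝ) + 1) atTop atTop :=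
    tendsto_atTop_add_const_right _ _ tendsto_natCast_atTop_atTop
  -- The base point b + 1/(n+1) approaches b from the right, more slowly than y = 1/(n+1)² shrinks,
  -- so that t = b receives the limit π/2 and a possible atom there is counted in full.
  have h1 := tendsto_integral_mul_arctan hF
    (u := fun n t => (b + 1 / ((n : ℝ) + 1) - t) / (1 / ((n : ℝ) + 1) ^ 2))
    (g := fun t => if t ∈ Set.Iic b then Real.pi / 2 else -(Real.pi / 2))
    (fun n => by fun_prop) (fun t => by
      have heq : ∀ n : ℕ, (b + 1 / ((n : ℝ) + 1) - t) / (1 / ((n : ℝ) + 1) ^ 2) =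
          ((n : ℝ) + 1) * (((n : ℝ) + 1) * (b - t) + 1) := fun n => by field_simp; ring
      simp only [heq]
      split_ifs with h
      · refine htop.comp (tendsto_atTop_mono (fun n => ?_) hN)
        have : 0 ≤ b - t := sub_nonneg.2 h
        nlinarith [mul_nonneg (by positivity : (0 : ℝ) ≤ ((n : ℝ) + 1) ^ 2) this]
      · refine hbot.comp (hN.atTop_mul_atBot₀ ?_)
        refine tendsto_atBot_add_const_right _ _ (hN.atTop_mul_const_of_neg ?_)
        simpa using h)
  have h2 := tendsto_integral_mul_arctan hF
    (u := fun n t => (-((n : ℝ) + 1) - t) / (1 / ((n : ℝ) + 1) ^ 2))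
    (g := fun t => -(Real.pi / 2))
    (fun n => by fun_prop) (fun t => by
      have heq : ∀ n : ℕ, (-((n : ℝ) + 1) - t) / (1 / ((n : ℝ) + 1) ^ 2) =
          ((n : ℝ) + 1) ^ 2 * (-((n : ℝ) + 1) + -t) := fun n => by field_simp; ring
      simp only [heq]
      refine hbot.comp (Tendsto.atTop_mul_atBot₀ ((tendsto_pow_atTop two_ne_zero).comp hN) ?_)
      exact tendsto_atBot_add_const_right _ _ (tendsto_neg_atTop_atBot.comp hN))
  have h3 := tendsto_nhds_unique h1 (h2.congr fun n =>
    integral_mul_arctan_eq hF h0 (by positivity) _ _)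
  have h4 : ∀ t, F t * (((if t ∈ Set.Iic b then Real.pi / 2 else -(Real.pi / 2) : ℝ)) : ℂ) -
      F t * ((-(Real.pi / 2) : ℝ) : ℂ) = Set.indicator (Set.Iic b) F t * (Real.pi : ℂ) := by
    intro t
    by_cases ht : t ∈ Set.Iic b
    · simp only [ht, if_true, Set.indicator_of_mem]
      push_cast
      ring
    · simp [ht]
  have h5 : ∫ t, Set.indicator (Set.Iic b) F t * (Real.pi : ℂ) ∂α = 0 := by
    simp only [← h4]
    rw [integral_sub _ (hF.mul_const _), h3, sub_self]
    have h6 := ((hF.indicator (measurableSet_Iic (a := b))).mul_const (Real.pi : ℂ)).add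
      (hF.mul_const ((-(Real.pi / 2) : ℝ) : ℂ))
    refine h6.congr (Eventually.of_forall fun t => ?_)
    simp only [Pi.add_apply, ← h4]
    ring
  rw [integral_mul_const, integral_indicator measurableSet_Iic] at h5
  exact (mul_eq_zero.1 h5).resolve_right (by exact_mod_cast Real.pi_ne_zero)

/-- An integrable function whose Stieltjes transform vanishes is zero almost everywhere. -/
theorem ae_eq_zero_of_integral_div_eq_zero {α : Measure ℝ} [IsFiniteMeasure α] {F : ℝ → ℂ}
    (hF : Integrable F α)
    (h0 : ∀ z : ℂ, z.im ≠ 0 → ∫ t : ℝ, F t / ((t : ℂ) - z) ∂α = 0) : F =ᵐ[α] 0 := by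
  have hIic := setIntegral_Iic_eq_zero hF h0
  have huniv : ∫ t, F t ∂α = 0 := by
    have hcov : AECover α atTop (fun n : ℕ => Set.Iic (n : ℝ)) :=
      aecover_Iic tendsto_natCast_atTop_atTop
    have := hcov.integral_tendsto_of_countably_generated hF
    simp only [hIic] at this
    exact tendsto_nhds_unique this tendsto_const_nhds
  refine Integrable.ae_eq_zero_of_forall_setIntegral_eq_zero hF fun s hs _ => ?_
  induction s, hs using MeasurableSpace.induction_on_inter
    (borel_eq_generateFrom_Iic ℝ ▸ (BorelSpace.measurable_eq (α := ℝ))) isPiSystem_Iic with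
  | empty => simp
  | basic s hs =>
    obtain ⟨b, rfl⟩ := hs
    exact hIic b
  | compl s hs ih =>
    rw [setIntegral_compl hs hF, huniv, ih (measure_lt_top _ _), sub_zero]
  | iUnion f hd hf ih =>
    rw [integral_iUnion hf hd hF.integrableOn]
    simp [ih _ (measure_lt_top _ _)]

/-- Over a determinate measure, a square integrable function `ψ` is determined off the origin by
the integrals of `ψ` against the monomials of positive degree. -/
theorem HamburgerDeterminate.mul_self_ae_eq_zero {α : Measure ℝ} [IsFiniteMeasure α]
    (hα : HamburgerDeterminate α) {ψ : ℝ → ℂ} (hψ : MemLp ψ 2 α)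
    (h0 : ∀ n : ℕ, ∫ t : ℝ, ψ t * (t : ℂ) ^ (n + 1) ∂α = 0) :
    (fun t : ℝ => ψ t * t) =ᵐ[α] 0 := by
  have hint : Integrable (fun t : ℝ => ψ t * t) α := by
    simpa using hα.1.integrable_mul_eval hψ Polynomial.X
  exact ae_eq_zero_of_integral_div_eq_zero hint fun z hz => hα.integral_div_eq_zero hψ h0 hz

/-! ### The spectral description of `H(K)` -/

theorem integrable_mul_cexp {α : Measure ℝ} {χ : ℝ → ℂ} (hχ : Integrable χ α) (x : ℝ) :
    Integrable (fun t : ℝ => χ t * Complex.exp (t * x * Complex.I)) α := by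
  refine hχ.norm.mono' (hχ.1.mul (Continuous.aestronglyMeasurable (by fun_prop)))
    (Eventually.of_forall fun t => ?_)
  rw [norm_mul, show (t : ℂ) * x * Complex.I = ((t * x : ℝ) : ℂ) * Complex.I by push_cast; ring,
    Complex.norm_exp_ofReal_mul_I, mul_one]

theorem IsSpectralMeasure.integral_cexp {k : ℝ → ℝ} {α : Measure ℝ} (hα : IsSpectralMeasure k α)
    (x : ℝ) : ∫ t : ℝ, Complex.exp (t * x * Complex.I) ∂α = k x := by
  rw [hα.2 x]
  congr 1 with t
  ring_nf

theorem IsSpectralMeasure.integrable_cexp {k : ℝ → ℝ} {α : Measure ℝ}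
    (hα : IsSpectralMeasure k α) (x : ℝ) :
    Integrable (fun t : ℝ => Complex.exp (t * x * Complex.I)) α := by
  have := hα.1
  simpa using integrable_mul_cexp (integrable_const (1 : ℂ)) x

theorem IsSpectralMeasure.integrable_cos {k : ℝ → ℝ} {α : Measure ℝ}
    (hα : IsSpectralMeasure k α) (x : ℝ) : Integrable (fun t : ℝ => Real.cos (t * x)) α := by
  refine (hα.integrable_cexp x).re.congr (Eventually.of_forall fun t => ?_)
  simp only [← Complex.ofReal_mul, Complex.exp_ofReal_mul_I_re, RCLike.re_to_complex]

theorem IsSpectralMeasure.integrable_sin {k : ℝ → ℝ} {α : Measure ℝ}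
    (hα : IsSpectralMeasure k α) (x : ℝ) : Integrable (fun t : ℝ => Real.sin (t * x)) α := by
  refine (hα.integrable_cexp x).im.congr (Eventually.of_forall fun t => ?_)
  simp only [← Complex.ofReal_mul, Complex.exp_ofReal_mul_I_im, RCLike.im_to_complex]

theorem IsSpectralMeasure.integral_cos {k : ℝ → ℝ} {α : Measure ℝ} (hα : IsSpectralMeasure k α)
    (x : ℝ) : ∫ t, Real.cos (t * x) ∂α = k x := by
  have h := integral_re (hα.integrable_cexp x)
  rw [hα.integral_cexp] at h
  simpa only [← Complex.ofReal_mul, Complex.exp_ofReal_mul_I_re, RCLike.re_to_complex,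
    Complex.ofReal_re] using h

theorem IsSpectralMeasure.integral_sin {k : ℝ → ℝ} {α : Measure ℝ} (hα : IsSpectralMeasure k α)
    (x : ℝ) : ∫ t, Real.sin (t * x) ∂α = 0 := by
  have h := integral_im (hα.integrable_cexp x)
  rw [hα.integral_cexp] at h
  simpa only [← Complex.ofReal_mul, Complex.exp_ofReal_mul_I_im, RCLike.im_to_complex,
    Complex.ofReal_im] using h

/-- The function cos(tx) + sin(tx) serves as a real feature map in place of e^{itx}: a product of
two is cos(t(x - y)) + sin(t(x + y)), and the sine integrates to 0 because k is real. -/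
theorem memLp_cos_add_sin {α : Measure ℝ} [IsFiniteMeasure α] (x : ℝ) :
    MemLp (fun t : ℝ => Real.cos (t * x) + Real.sin (t * x)) 2 α := by
  refine MemLp.of_bound (Continuous.aestronglyMeasurable (by fun_prop)) 2
    (Eventually.of_forall fun t => ?_)
  refine (norm_add_le _ _).trans ?_
  have h1 := Real.abs_cos_le_one (t * x)
  have h2 := Real.abs_sin_le_one (t * x)
  rw [Real.norm_eq_abs, Real.norm_eq_abs]
  linarith

/-- The reproducing kernel Hilbert space of `k (x - y)` consists of the transforms of the square
integrable functions on the spectral side. -/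
theorem mem_rkhs_translationKernel_iff {k : ℝ → ℝ} (hk : IsPosDefFun k) {α : Measure ℝ}
    (hα : IsSpectralMeasure k α) (X : Set ℝ) (f : X → ℝ) :
    f ∈ rkhs (translationKernel k X) (hk.translationKernel X) ↔
      ∃ φ : ℝ → ℝ, MemLp φ 2 α ∧
        ∀ x : X, f x = ∫ t, φ t * (Real.cos (t * x) + Real.sin (t * x)) ∂α := by
  have := hα.1
  let b : X → Lp ℝ 2 α := fun x => (memLp_cos_add_sin (α := α) (x : ℝ)).toLp _
  have hb : ∀ x : X, b x =ᵐ[α] fun t => Real.cos (t * x) + Real.sin (t * x) :=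
    fun x => MemLp.coeFn_toLp _
  have hinner : ∀ (w : Lp ℝ 2 α) (x : X),
      inner ℝ w (b x) = ∫ t, w t * (Real.cos (t * x) + Real.sin (t * x)) ∂α := by
    intro w x
    rw [L2.inner_def]
    refine integral_congr_ae ?_
    filter_upwards [hb x] with t ht
    simp [ht, mul_comm]
  have hgram : ∀ x y : X, translationKernel k X x y = inner ℝ (b x) (b y) := by
    intro x y
    rw [hinner]
    have h1 : ∫ t, b x t * (Real.cos (t * y) + Real.sin (t * y)) ∂α =
        ∫ t, (Real.cos (t * (x - y)) + Real.sin (t * (x + y))) ∂α := by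
      refine integral_congr_ae ?_
      filter_upwards [hb x] with t ht
      rw [ht, mul_sub, mul_add t, Real.cos_sub, Real.sin_add]
      ring
    rw [h1, integral_add (hα.integrable_cos _) (hα.integrable_sin _), hα.integral_cos,
      hα.integral_sin, add_zero]
    rfl
  rw [mem_rkhs_iff (hk.translationKernel X) b hgram]
  constructor
  · rintro ⟨w, hw⟩
    exact ⟨w, Lp.memLp w, fun x => by rw [hw, hinner]⟩
  · rintro ⟨φ, hφ, hf⟩
    refine ⟨hφ.toLp φ, fun x => ?_⟩
    rw [hf, hinner]
    refine integral_congr_ae ?_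
    filter_upwards [hφ.coeFn_toLp] with t ht
    rw [ht]

/-- The characteristic function is real, so reflection leaves it unchanged. -/
theorem IsSpectralMeasure.measurePreserving_neg {k : ℝ → ℝ} {α : Measure ℝ}
    (hα : IsSpectralMeasure k α) : MeasurePreserving (fun t : ℝ => -t) α α := by
  have := hα.1
  refine ⟨measurable_neg, Measure.ext_of_charFun (funext fun x => ?_)⟩
  have hchar : ∀ x, charFun α x = k x := by
    intro x
    rw [charFun_apply_real, ← hα.integral_cexp]
    simp only [mul_comm (x : ℂ)]
  have h1 : charFun (α.map fun t => -t) x = charFun α (-x) := by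
    rw [charFun_apply_real, charFun_apply_real,
      integral_map measurable_neg.aemeasurable (Continuous.aestronglyMeasurable (by fun_prop))]
    simp
  rw [h1, charFun_neg, hchar, Complex.conj_ofReal]

theorem exists_integral_mul_cexp_of_mem_rkhs {k : ℝ → ℝ} (hk : IsPosDefFun k) {α : Measure ℝ}
    (hα : IsSpectralMeasure k α) {X : Set ℝ} {f : X → ℝ}
    (hf : f ∈ rkhs (translationKernel k X) (hk.translationKernel X)) :
    ∃ χ : ℝ → ℂ, MemLp χ 2 α ∧
      ∀ x : X, (f x : ℂ) = ∫ t : ℝ, χ t * Complex.exp (t * (x : ℝ) * Complex.I) ∂α := by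
  have := hα.1
  obtain ⟨φ, hφ, hfφ⟩ := (mem_rkhs_translationKernel_iff hk hα X f).1 hf
  have hneg := hα.measurePreserving_neg
  have hφC : MemLp (fun t => (φ t : ℂ)) 2 α := hφ.ofReal
  have hφC' : MemLp (fun t => (φ (-t) : ℂ)) 2 α := hφC.comp_measurePreserving hneg
  -- Comes from cos θ + sin θ = (1 - i)/2 · e^{iθ} + (1 + i)/2 · e^{-iθ}, with the second term
  -- reflected through the symmetry of α.
  refine ⟨fun t => (1 - Complex.I) / 2 * φ t + (1 + Complex.I) / 2 * φ (-t),
    (hφC.const_mul _).add (hφC'.const_mul _), fun x => ?_⟩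
  have hi1 := integrable_mul_cexp (hφC.integrable one_le_two) x
  have hi2 := integrable_mul_cexp (hφC'.integrable one_le_two) x
  have hi3 := integrable_mul_cexp (hφC.integrable one_le_two) (-x)
  have h1 : ∫ t : ℝ, (φ (-t) : ℂ) * Complex.exp (t * (x : ℝ) * Complex.I) ∂α =
      ∫ t : ℝ, (φ t : ℂ) * Complex.exp (t * ((-x : ℝ) : ℂ) * Complex.I) ∂α := by
    rw [← hneg.integral_comp (MeasurableEquiv.neg ℝ).measurableEmbedding]
    simp
  have h2 : ∀ t : ℝ, ((1 - Complex.I) / 2 * φ t + (1 + Complex.I) / 2 * φ (-t)) *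
      Complex.exp (t * (x : ℝ) * Complex.I) =
      (1 - Complex.I) / 2 * (φ t * Complex.exp (t * (x : ℝ) * Complex.I)) +
      (1 + Complex.I) / 2 * (φ (-t) * Complex.exp (t * (x : ℝ) * Complex.I)) := fun t => by ring
  simp only [h2]
  rw [integral_add (hi1.const_mul _) (hi2.const_mul _), integral_const_mul, integral_const_mul, h1,
    ← integral_const_mul, ← integral_const_mul, ← integral_add (hi1.const_mul _) (hi3.const_mul _),
    hfφ, ← integral_complex_ofReal]
  congr 1 with t
  push_cast
  rw [← Complex.cos_add_sin_I, ← Complex.cos_add_sin_I, mul_neg, Complex.cos_neg, Complex.sin_neg]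
  linear_combination ((φ t : ℂ) * Complex.sin (t * (x : ℝ))) * Complex.I_sq

/-! ### Differentiating transforms, and the constants -/

theorem hasDerivAt_integral_mul_cexp {α : Measure ℝ} {χ : ℝ → ℂ} (hχ : Integrable χ α)
    (hχ1 : Integrable (fun t : ℝ => χ t * (t * Complex.I)) α) (x : ℝ) :
    HasDerivAt (fun x : ℝ => ∫ t : ℝ, χ t * Complex.exp (t * x * Complex.I) ∂α)
      (∫ t : ℝ, χ t * (t * Complex.I) * Complex.exp (t * x * Complex.I) ∂α) x := by
  refine (hasDerivAt_integral_of_dominated_loc_of_deriv_le (s := Set.univ)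
    (F := fun (x t : ℝ) => χ t * Complex.exp (t * x * Complex.I))
    (F' := fun (x t : ℝ) => χ t * (t * Complex.I) * Complex.exp (t * x * Complex.I))
    (bound := fun t => ‖χ t * (t * Complex.I)‖) Filter.univ_mem
    (Eventually.of_forall fun x => (integrable_mul_cexp hχ x).1) (integrable_mul_cexp hχ x)
    (integrable_mul_cexp hχ1 x).1 ?_ hχ1.norm ?_).2
  · refine Eventually.of_forall fun t x _ => ?_
    rw [norm_mul _ (Complex.exp _),
      show (t : ℂ) * x * Complex.I = ((t * x : ℝ) : ℂ) * Complex.I by push_cast; ring,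
      Complex.norm_exp_ofReal_mul_I, mul_one]
  · refine Eventually.of_forall fun t x _ => ?_
    have h1 : HasDerivAt (fun x : ℝ => (t : ℂ) * x * Complex.I) (t * Complex.I) x := by
      simpa using ((Complex.ofRealCLM.hasDerivAt (x := x)).const_mul (t : ℂ)).mul_const Complex.I
    exact (h1.cexp.const_mul (χ t)).congr_deriv (by ring)

theorem hasDerivAt_integral_mul_pow_mul_cexp {α : Measure ℝ} {χ : ℝ → ℂ}
    (hχ : ∀ n : ℕ, Integrable (fun t : ℝ => χ t * (t : ℂ) ^ n) α) (n : ℕ) (x : ℝ) :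
    HasDerivAt
      (fun x : ℝ => ∫ t : ℝ, χ t * (t * Complex.I) ^ n * Complex.exp (t * x * Complex.I) ∂α)
      (∫ t : ℝ, χ t * (t * Complex.I) ^ (n + 1) * Complex.exp (t * x * Complex.I) ∂α) x := by
  have hint : ∀ n : ℕ, Integrable (fun t : ℝ => χ t * (t * Complex.I) ^ n) α := fun n => by
    simpa only [mul_pow, mul_assoc] using (hχ n).mul_const (Complex.I ^ n)
  have h := hasDerivAt_integral_mul_cexp (hint n)
    (by simpa only [pow_succ, mul_assoc] using hint (n + 1)) x
  simpa only [pow_succ, mul_assoc] using h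

theorem atom_zero_pos_of_const_mem_rkhs {X : Set ℝ} (hX : (interior X).Nonempty) {k : ℝ → ℝ}
    (hk : IsPosDefFun k) {α : Measure ℝ} (hα : IsSpectralMeasure k α)
    (hdet : HamburgerDeterminate α) {c : ℝ} (hc : c ≠ 0)
    (hmem : (fun _ : X => c) ∈ rkhs (translationKernel k X) (hk.translationKernel X)) :
    0 < α {0} := by
  have := hα.1
  obtain ⟨χ, hχ, hcχ⟩ := exists_integral_mul_cexp_of_mem_rkhs hk hα hmem
  obtain ⟨x₀, hx₀⟩ := hX
  have hint : ∀ n : ℕ, Integrable (fun t : ℝ => χ t * (t : ℂ) ^ n) α := fun n => by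
    simpa using hdet.1.integrable_mul_eval hχ (Polynomial.X ^ n)
  let G : ℕ → ℝ → ℂ := fun n x =>
    ∫ t : ℝ, χ t * (t * Complex.I) ^ n * Complex.exp (t * x * Complex.I) ∂α
  have hG : ∀ n x, HasDerivAt (G n) (G (n + 1) x) x := hasDerivAt_integral_mul_pow_mul_cexp hint
  have hG0 : ∀ x ∈ interior X, G 0 x = c := by
    intro x hx
    have := hcχ ⟨x, interior_subset hx⟩
    simp only [G, pow_zero, mul_one]
    exact this.symm
  have hstep : ∀ n (d : ℂ), (∀ x ∈ interior X, G n x = d) → ∀ x ∈ interior X, G (n + 1) x = 0 := by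
    intro n d h x hx
    have hev : G n =ᶠ[𝓝 x] fun _ => d := by
      filter_upwards [isOpen_interior.mem_nhds hx] with y hy using h y hy
    exact (hG n x).unique ((hasDerivAt_const x d).congr_of_eventuallyEq hev)
  have hGn : ∀ n, ∀ x ∈ interior X, G (n + 1) x = 0 := by
    intro n
    induction n with
    | zero => exact hstep 0 c hG0
    | succ n ih => exact hstep (n + 1) 0 ih
  have hψ : MemLp (fun t : ℝ => χ t * Complex.exp (t * x₀ * Complex.I)) 2 α := by
    refine hχ.of_le (hχ.1.mul (Continuous.aestronglyMeasurable (by fun_prop)))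
      (Eventually.of_forall fun t => ?_)
    rw [norm_mul,
      show (t : ℂ) * x₀ * Complex.I = ((t * x₀ : ℝ) : ℂ) * Complex.I by push_cast; ring,
      Complex.norm_exp_ofReal_mul_I, mul_one]
  -- Up to powers of i, the derivatives of positive order at x₀ are the integrals of ψ against
  -- monomials of positive degree.
  have hzero := hdet.mul_self_ae_eq_zero hψ fun n => by
    have h := hGn n x₀ hx₀
    have h1 : G (n + 1) x₀ = Complex.I ^ (n + 1) *
        ∫ t : ℝ, χ t * Complex.exp (t * x₀ * Complex.I) * (t : ℂ) ^ (n + 1) ∂α := by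
      rw [← integral_const_mul]
      simp only [G, mul_pow]
      congr 1 with t
      ring
    rw [h1] at h
    exact (mul_eq_zero.1 h).resolve_left (pow_ne_zero _ Complex.I_ne_zero)
  rw [pos_iff_ne_zero]
  intro h0
  have hne : ∀ᵐ t ∂α, t ≠ (0 : ℝ) := by
    rw [ae_iff]
    simpa using h0
  have hcz : (c : ℂ) = 0 := by
    rw [← hG0 x₀ hx₀]
    refine integral_eq_zero_of_ae ?_
    filter_upwards [hzero, hne] with t ht ht0
    simp only [pow_zero, mul_one, Pi.zero_apply]
    exact (mul_eq_zero.1 ht).resolve_right (by exact_mod_cast ht0)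
  exact hc (by exact_mod_cast hcz)

theorem const_mem_rkhs_of_atom_zero_pos (X : Set ℝ) {k : ℝ → ℝ} (hk : IsPosDefFun k)
    {α : Measure ℝ} (hα : IsSpectralMeasure k α) (h0 : 0 < α {0}) (c : ℝ) :
    (fun _ : X => c) ∈ rkhs (translationKernel k X) (hk.translationKernel X) := by
  have := hα.1
  rw [mem_rkhs_translationKernel_iff hk hα]
  have hpos : 0 < α.real {0} := ENNReal.toReal_pos h0.ne' (measure_ne_top _ _)
  refine ⟨Set.indicator {0} fun _ => c / α.real {0},
    memLp_indicator_const 2 (measurableSet_singleton 0) _ (Or.inr (measure_ne_top _ _)),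
    fun x => ?_⟩
  have h : ∀ t : ℝ, Set.indicator {0} (fun _ => c / α.real {0}) t *
      (Real.cos (t * x) + Real.sin (t * x)) =
      Set.indicator {(0 : ℝ)} (fun _ => c / α.real {0}) t := by
    intro t
    by_cases ht : t = 0
    · subst ht; simp
    · simp [ht]
  simp only [h]
  rw [integral_indicator_const _ (measurableSet_singleton 0), smul_eq_mul,
    mul_div_cancel₀ _ hpos.ne']

/-! ### Analytic kernels and polynomials -/

theorem AnalyticAt.exists_norm_iteratedDeriv_le {f : ℝ → ℂ} {x : ℝ} (hf : AnalyticAt ℝ f x) :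
    ∃ C a : ℝ, 0 < C ∧ 0 < a ∧ ∀ n, ‖iteratedDeriv n f x‖ ≤ n.factorial * (C * a ^ n) := by
  obtain ⟨p, r, hp⟩ := hf
  obtain ⟨C, a, hC, ha, h⟩ := p.le_mul_pow_of_radius_pos (hp.r_pos.trans_le hp.r_le)
  refine ⟨C, a, hC, ha, fun n => ?_⟩
  have h1 := hp.factorial_smul 1 n
  rw [iteratedDeriv, ← h1, nsmul_eq_mul, norm_mul, Complex.norm_natCast]
  gcongr
  refine ((p n).le_opNorm _).trans ?_
  simpa using h n

theorem IsSpectralMeasure.iteratedDeriv_eq {k : ℝ → ℝ} {α : Measure ℝ}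
    (hα : IsSpectralMeasure k α) (hm : HasMoments α) (n : ℕ) :
    iteratedDeriv n (fun x => (k x : ℂ)) =
      fun x : ℝ => ∫ t : ℝ, (t * Complex.I) ^ n * Complex.exp (t * x * Complex.I) ∂α := by
  induction n with
  | zero =>
    ext x
    simp [hα.integral_cexp]
  | succ n ih =>
    rw [iteratedDeriv_succ, ih]
    ext x
    have hint : ∀ n : ℕ, Integrable (fun t : ℝ => (1 : ℂ) * (t : ℂ) ^ n) α := fun n => by
      simpa using (hm n).ofReal (𝕜 := ℂ)
    have := (hasDerivAt_integral_mul_pow_mul_cexp hint n x).deriv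
    simpa only [one_mul] using this

/-- The even moments are, up to sign, derivatives of k at 0, so analyticity bounds them by C (2n)!
a^{2n}. Summing the series of cosh(rt) term by term gives the exponential moment. -/
theorem IsSpectralMeasure.exists_integrable_exp_mul_abs {k : ℝ → ℝ} {α : Measure ℝ}
    (hα : IsSpectralMeasure k α) (hm : HasMoments α) (hk : AnalyticAt ℝ k 0) :
    ∃ r : ℝ, 0 < r ∧ Integrable (fun t => Real.exp (r * |t|)) α := by
  have hkC : AnalyticAt ℝ (fun x => (k x : ℂ)) 0 :=
    (Complex.ofRealCLM.analyticAt _).comp hk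
  obtain ⟨C, a, hC, ha, hbound⟩ := hkC.exists_norm_iteratedDeriv_le
  have hmom : ∀ n : ℕ, ∫ t, t ^ (2 * n) ∂α ≤ (2 * n).factorial * (C * a ^ (2 * n)) := by
    intro n
    refine le_trans ?_ (hbound (2 * n))
    rw [hα.iteratedDeriv_eq hm]
    have h1 : ∀ t : ℝ, ((t : ℂ) * Complex.I) ^ (2 * n) * Complex.exp (t * (0 : ℝ) * Complex.I) =
        (-1) ^ n * ((t ^ (2 * n) : ℝ) : ℂ) := by
      intro t
      rw [mul_pow, pow_mul Complex.I, Complex.I_sq]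
      simp [mul_comm]
    simp only [h1]
    rw [integral_const_mul, integral_complex_ofReal, norm_mul, norm_pow, norm_neg, norm_one,
      one_pow, one_mul, Complex.norm_real]
    exact le_abs_self _
  -- With ra = 1/2 the integrated series is dominated by a geometric one of ratio 1/4.
  set r : ℝ := 1 / (2 * a) with hr
  have hrpos : 0 < r := by positivity
  have hra : r * a = 1 / 2 := by rw [hr]; field_simp
  have hnonneg : ∀ (n : ℕ) (t : ℝ), 0 ≤ (r * t) ^ (2 * n) / ((2 * n).factorial : ℝ) := by
    intro n t
    rw [pow_mul]
    positivity
  have hint : ∀ n : ℕ, Integrable (fun t => (r * t) ^ (2 * n) / ((2 * n).factorial : ℝ)) α := by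
    intro n
    simp only [mul_pow]
    exact ((hm (2 * n)).const_mul _).div_const _
  have hle : ∀ n : ℕ, ∫ t, (r * t) ^ (2 * n) / ((2 * n).factorial : ℝ) ∂α ≤
      C * (1 / 4) ^ n := by
    intro n
    simp only [mul_pow]
    rw [integral_div, integral_const_mul, div_le_iff₀ (by positivity)]
    calc r ^ (2 * n) * ∫ t, t ^ (2 * n) ∂α
        ≤ r ^ (2 * n) * ((2 * n).factorial * (C * a ^ (2 * n))) := by
          gcongr
          exact hmom n
      _ = C * (r * a) ^ (2 * n) * (2 * n).factorial := by rw [mul_pow]; ring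
      _ = C * (1 / 4) ^ n * (2 * n).factorial := by rw [hra, pow_mul]; norm_num
  have hsum : Summable fun n : ℕ => ∫ t, (r * t) ^ (2 * n) / ((2 * n).factorial : ℝ) ∂α :=
    Summable.of_nonneg_of_le (fun n => integral_nonneg (hnonneg n)) hle
      ((summable_geometric_of_lt_one (by norm_num) (by norm_num)).mul_left C)
  have hcosh : Integrable (fun t => Real.cosh (r * t)) α := by
    refine ⟨Continuous.aestronglyMeasurable (by fun_prop), ?_⟩
    rw [hasFiniteIntegral_iff_ofReal (Eventually.of_forall fun t => (Real.cosh_pos _).le)]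
    have h1 : ∀ t : ℝ, ENNReal.ofReal (Real.cosh (r * t)) =
        ∑' n : ℕ, ENNReal.ofReal ((r * t) ^ (2 * n) / ((2 * n).factorial : ℝ)) := by
      intro t
      rw [← (Real.hasSum_cosh (r * t)).tsum_eq,
        ENNReal.ofReal_tsum_of_nonneg (fun n => hnonneg n t) (Real.hasSum_cosh (r * t)).summable]
    simp only [h1]
    rw [lintegral_tsum fun n => by fun_prop]
    simp only [← ofReal_integral_eq_lintegral_ofReal (hint _) (Eventually.of_forall (hnonneg _))]
    exact hsum.tsum_ofReal_lt_top
  refine ⟨r, hrpos, (hcosh.const_mul 2).mono' (Continuous.aestronglyMeasurable (by fun_prop))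
    (Eventually.of_forall fun t => ?_)⟩
  rw [Real.norm_eq_abs, abs_of_pos (Real.exp_pos _), ← Real.cosh_abs, abs_mul, abs_of_pos hrpos,
    Real.cosh_eq]
  linarith [Real.exp_pos (-(r * |t|))]

/-- Integrability with exponent 2s, twice the half-width of the strip, leaves a factor exp(s|t|) to
absorb the t produced by differentiation. -/
theorem analyticOnNhd_integral_mul_exp {α : Measure ℝ} {φ : ℝ → ℂ} {s : ℝ} (hs : 0 < s)
    (hφm : AEStronglyMeasurable φ α)
    (hφ : Integrable (fun t => ‖φ t‖ * Real.exp (2 * s * |t|)) α) :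
    AnalyticOnNhd ℂ (fun z : ℂ => ∫ t : ℝ, φ t * Complex.exp (t * z) ∂α) {z | |z.re| < s} := by
  have hopen : IsOpen {z : ℂ | |z.re| < s} :=
    isOpen_lt (by fun_prop) continuous_const
  have hexp : ∀ (t : ℝ) (z : ℂ), |z.re| < s →
      ‖Complex.exp (t * z)‖ ≤ Real.exp (s * |t|) := by
    intro t z hz
    rw [Complex.norm_exp, Complex.re_ofReal_mul]
    refine Real.exp_le_exp.2 ((le_abs_self _).trans ?_)
    rw [abs_mul, mul_comm]
    gcongr
  have hmeas : ∀ z : ℂ, AEStronglyMeasurable (fun t : ℝ => φ t * Complex.exp (t * z)) α :=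
    fun z => hφm.mul (Continuous.aestronglyMeasurable (by fun_prop))
  refine DifferentiableOn.analyticOnNhd (fun z hz => ?_) hopen
  refine (hasDerivAt_integral_of_dominated_loc_of_deriv_le (hopen.mem_nhds hz)
    (F := fun (z : ℂ) (t : ℝ) => φ t * Complex.exp (t * z))
    (F' := fun (z : ℂ) (t : ℝ) => φ t * (Complex.exp (t * z) * t))
    (bound := fun t => s⁻¹ * (‖φ t‖ * Real.exp (2 * s * |t|)))
    (Eventually.of_forall hmeas) ?_ ?_ ?_ (hφ.const_mul _) ?_).2.differentiableAt
    |>.differentiableWithinAt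
  · refine hφ.mono' (hmeas z) (Eventually.of_forall fun t => ?_)
    rw [norm_mul]
    gcongr
    refine (hexp t z hz).trans (Real.exp_le_exp.2 ?_)
    nlinarith [mul_nonneg hs.le (abs_nonneg t)]
  · exact hφm.mul (Continuous.aestronglyMeasurable (by fun_prop))
  · refine Eventually.of_forall fun t w hw => ?_
    have h1 : s * |t| ≤ Real.exp (s * |t|) := by linarith [Real.add_one_le_exp (s * |t|)]
    have h2 : Real.exp (2 * s * |t|) = Real.exp (s * |t|) * Real.exp (s * |t|) := by
      rw [← Real.exp_add]; ring_nf
    have h3 : |t| ≤ s⁻¹ * Real.exp (s * |t|) := by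
      rw [inv_mul_eq_div, le_div_iff₀ hs]; linarith
    rw [norm_mul, norm_mul, Complex.norm_real, Real.norm_eq_abs]
    calc ‖φ t‖ * (‖Complex.exp (t * w)‖ * |t|)
        ≤ ‖φ t‖ * (Real.exp (s * |t|) * (s⁻¹ * Real.exp (s * |t|))) := by
          gcongr
          exact hexp t w hw
      _ = s⁻¹ * (‖φ t‖ * Real.exp (2 * s * |t|)) := by rw [h2]; ring
  · refine Eventually.of_forall fun t w _ => ?_
    have h1 : HasDerivAt (fun w : ℂ => (t : ℂ) * w) t w := by
      simpa using (hasDerivAt_id w).const_mul (t : ℂ)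
    exact h1.cexp.const_mul (φ t)

theorem analyticOnNhd_integral_mul_cexp {α : Measure ℝ} {r : ℝ} (hr : 0 < r)
    (hexp : Integrable (fun t => Real.exp (r * |t|)) α) {χ : ℝ → ℂ} (hχ : MemLp χ 2 α) :
    AnalyticOnNhd ℝ (fun x : ℝ => ∫ t : ℝ, χ t * Complex.exp (t * x * Complex.I) ∂α)
      Set.univ := by
  -- This is exp(r|t|/2), whose square is integrable; by Cauchy–Schwarz its product with |χ| is
  -- integrable.
  have hE : MemLp (fun t => Real.exp (2 * (r / 4) * |t|)) 2 α := by
    rw [memLp_two_iff_integrable_sq (Continuous.aestronglyMeasurable (by fun_prop))]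
    refine hexp.congr (Eventually.of_forall fun t => ?_)
    simp only [sq]
    rw [← Real.exp_add]
    ring_nf
  have h := analyticOnNhd_integral_mul_exp (s := r / 4) (by linarith) hχ.1
    (hχ.norm.integrable_mul hE)
  intro x _
  have hx : ((x : ℂ) * Complex.I) ∈ {z : ℂ | |z.re| < r / 4} := by simp [hr]
  have h1 : AnalyticAt ℝ (fun x : ℝ => (x : ℂ) * Complex.I) x :=
    (Complex.ofRealCLM.analyticAt x).mul analyticAt_const
  have h2 := ((h _ hx).restrictScalars (𝕜 := ℝ)).comp_of_eq h1 rfl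
  refine h2.congr (Eventually.of_forall fun y => ?_)
  simp [mul_assoc]

theorem polynomial_notMem_rkhs {X : Set ℝ} (hX : (interior X).Nonempty) {k : ℝ → ℝ}
    (hk : IsPosDefFun k) {α : Measure ℝ} (hα : IsSpectralMeasure k α) (hm : HasMoments α)
    (hka : AnalyticAt ℝ k 0) {p : Polynomial ℝ} (hp : 0 < p.natDegree) :
    (fun x : X => p.eval (x : ℝ)) ∉ rkhs (translationKernel k X) (hk.translationKernel X) := by
  intro hmem
  have := hα.1
  obtain ⟨χ, hχ, hpχ⟩ := exists_integral_mul_cexp_of_mem_rkhs hk hα hmem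
  obtain ⟨r, hr, hexp⟩ := hα.exists_integrable_exp_mul_abs hm hka
  obtain ⟨x₀, hx₀⟩ := hX
  have hG := analyticOnNhd_integral_mul_cexp hr hexp hχ
  have hP : AnalyticOnNhd ℝ (fun x : ℝ => ((p.eval x : ℝ) : ℂ)) Set.univ := fun x _ =>
    (Complex.ofRealCLM.analyticAt _).comp (AnalyticOnNhd.eval_polynomial p x trivial)
  have heq := hP.eqOn_of_preconnected_of_eventuallyEq hG isPreconnected_univ (Set.mem_univ x₀) (by
    filter_upwards [isOpen_interior.mem_nhds hx₀] with x hx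
    exact hpχ ⟨x, interior_subset hx⟩)
  -- The identity theorem has carried the equality from a neighbourhood of x₀ to the whole line,
  -- where the transform is bounded.
  have hbound : ∀ x, |p.eval x| ≤ ∫ t, ‖χ t‖ ∂α := by
    intro x
    have h := heq (Set.mem_univ x)
    simp only at h
    rw [← Real.norm_eq_abs, ← Complex.norm_real, h]
    refine (norm_integral_le_integral_norm _).trans (le_of_eq ?_)
    congr 1 with t
    rw [norm_mul, show (t : ℂ) * x * Complex.I = ((t * x : ℝ) : ℂ) * Complex.I by push_cast; ring,
      Complex.norm_exp_ofReal_mul_I, mul_one]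
  have htend := p.abs_tendsto_atTop (Polynomial.natDegree_pos_iff_degree_pos.1 hp)
  obtain ⟨x, hx⟩ := (htend.eventually (eventually_gt_atTop (∫ t, ‖χ t‖ ∂α))).exists
  exact absurd (hbound x) (not_le.2 hx)

theorem corollary1 (X : Set ℝ) (hX : (interior X).Nonempty)
    (k : ℝ → ℝ) (hk : IsPosDefFun k) (hk0 : k 0 = 1) (hk_smooth : ContDiffAt ℝ ∞ k 0)
    (hk_nonconst : ¬ ∃ c : ℝ, ∀ x, k x = c)
    (α : Measure ℝ) (hα : IsSpectralMeasure k α) (hdet : HamburgerDeterminate α) :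
    (∀ c : ℝ, c ≠ 0 →
      ((fun _ : X => c) ∈ rkhs (translationKernel k X) (hk.translationKernel X) ↔ 0 < α {0})) ∧
    (AnalyticOnNhd ℝ k Set.univ →
      ∀ p : Polynomial ℝ, 0 < p.natDegree →
        (fun x : X => p.eval (x : ℝ)) ∉
          rkhs (translationKernel k X) (hk.translationKernel X)) :=
  ⟨fun c hc => ⟨atom_zero_pos_of_const_mem_rkhs hX hk hα hdet hc,
      fun h0 => const_mem_rkhs_of_atom_zero_pos X hk hα h0 c⟩,
    fun hka _ hp => polynomial_notMem_rkhs hX hk hα hdet.1 (hka 0 trivial) hp⟩
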